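/- Let $n \ge 9$ be an integer with $n \notin \{12, 14, 20, 32, 44\}$. Suppose that a regular $n$-gon is tiled with similar right triangles, i.e. that it is the union of finitely many non-degenerate right triangles that are pairwise similar (mirror images allowed) and have pairwise disjoint interiors (a vertex of one triangle may lie on a side of another). Then the smaller acute angle of these triangles is $\frac{\pi}{n}$ or $\frac{2\pi}{n}$. -/

import Mathlib

open Real EuclideanGeometry

/- The Euclidean plane is `ℂ`, with its usual distance and real inner product.
A (nondegenerate) triangle is `Affine.Triangle ℝ ℂ`: three affinely independent points. -/

/-- The angle of the triangle `t` at its vertex number `i` (the indices are taken modulo `3`). -/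
noncomputable def triangleAngle (t : Affine.Triangle ℝ ℂ) (i : Fin 3) : ℝ :=
  ∠ (t.points (i + 1)) (t.points i) (t.points (i + 2))

/-- A right triangle: one of the three angles is `π / 2`. -/
def IsRightTriangle (t : Affine.Triangle ℝ ℂ) : Prop :=
  ∃ i : Fin 3, triangleAngle t i = π / 2

/-- The smallest of the three angles of a triangle; in a right triangle this is the smaller one
of the two acute angles (or their common value). -/
noncomputable def smallestAngle (t : Affine.Triangle ℝ ℂ) : ℝ :=
  min (triangleAngle t 0) (min (triangleAngle t 1) (triangleAngle t 2))

/-- Two triangles are similar: for a suitable matching of their vertices, corresponding distances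
are proportional. Mirror images are allowed. -/
def SimilarTriangles (s t : Affine.Triangle ℝ ℂ) : Prop :=
  ∃ σ : Equiv.Perm (Fin 3), Similar s.points (t.points ∘ σ)

/-- The closed triangular region spanned by the three vertices. -/
def triangleRegion (t : Affine.Triangle ℝ ℂ) : Set ℂ :=
  convexHull ℝ (Set.range t.points)

/-- `P` is a (closed, filled) regular `n`-gon, of any centre `c`, size and position: the first
vertex is `c + r` with `r ≠ 0`, and the other ones are its successive rotations
around `c` by `2π / n`. -/
def IsRegularPolygon (n : ℕ) (P : Set ℂ) : Prop :=
  3 ≤ n ∧ ∃ c r : ℂ, r ≠ 0 ∧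
    P = convexHull ℝ
      (Set.range fun k : Fin n => c + r * Complex.exp (2 * π * Complex.I * (k : ℕ) / n))

/-- The finite family of triangles `T` tiles `P`: the triangles cover exactly `P`, and any two of
them have disjoint interiors. A vertex of one triangle may lie on a side of another. -/
def IsTiling {m : ℕ} (T : Fin m → Affine.Triangle ℝ ℂ) (P : Set ℂ) : Prop :=
  (⋃ i, triangleRegion (T i)) = P ∧
    ∀ i j, i ≠ j → Disjoint (interior (triangleRegion (T i))) (interior (triangleRegion (T j)))

/-! Angles are counted at every point of the plane. For a tiling of P, the angles of the tiles at x
add up to a number that depends only on P and x, so it can be computed from the fan of n isosceles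
triangles joining the centre to the sides: it is π - 2π/n at a vertex of the polygon and 0, π or 2π
elsewhere. Let α be the smaller acute angle and t = 2α/π ≤ 1/2. If p small, q large and r right
angles of tiles meet at x, then pt + q(1 - t) + r is 2 - 4/n at a polygon vertex and 0, 2 or 4
elsewhere, once straight and full angles are removed. Every tile has one small and one large angle,
so p and q have equal totals over the plane: a point with p > q forces one with p < q, and
conversely (`exists_lt_vertexCount`). Elementary arithmetic (`vertex_arithmetic`) then leaves t =
2/n, t = 4/n and the single stray case n = 28, t = 3/7.

The stray case satisfies all angle equations and needs a Galois argument. Its tiles have angles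
6π/28, 8π/28, 14π/28. The automorphism ζ ↦ ζ³ of the field of 56th roots of unity extends to an
additive map F of the plane, which sends vectors of direction dπ/28 to the line of direction 3dπ/28.
Replacing edge vectors by their images gives a twisted signed area, set to zero for tiles whose
sides do not have directions dπ/28 relative to the polygon. It is additive over tilings
(`sum_flux_eq`), because it is a sum of contributions of side ends that depend only on the point and
the direction. The right angle 14 becomes 42, whose sine is negative, while 6 and 8 become 18 and
24, whose sines are positive, so each tile has twisted area at most 0 (`flux_nonpos`). The central
angle 2 becomes 6, so each fan triangle has positive twisted area (`flux_fan_pos`), a contradiction.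
-/

/-! ### Barycentric coordinates and germs of triangles at a point -/

open Filter Topology in
theorem lex_eventually_pos {a b c : ℝ} (h : 0 < a ∨ (a = 0 ∧ (0 < b ∨ (b = 0 ∧ 0 < c)))) :
    ∀ᶠ ε : ℝ in 𝓝[>] 0, 0 < a + (ε * b + ε ^ 2 * c) := by
  have key : ∀ a b : ℝ, 0 < a → ∀ᶠ ε : ℝ in 𝓝[>] 0, 0 < a + ε * b := by
    intro a b ha
    have : Tendsto (fun ε : ℝ => a + ε * b) (𝓝 0) (𝓝 (a + 0 * b)) :=
      (Continuous.tendsto (by fun_prop) 0)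
    exact (this.eventually (lt_mem_nhds (by simpa using ha))).filter_mono nhdsWithin_le_nhds
  have hpos : ∀ᶠ ε : ℝ in 𝓝[>] 0, 0 < ε := self_mem_nhdsWithin
  rcases h with h | ⟨rfl, h | ⟨rfl, h⟩⟩
  · have : Tendsto (fun ε : ℝ => a + (ε * b + ε ^ 2 * c)) (𝓝 0) (𝓝 (a + (0 * b + 0 ^ 2 * c))) :=
      (Continuous.tendsto (by fun_prop) 0)
    exact (this.eventually (lt_mem_nhds (by simpa using h))).filter_mono nhdsWithin_le_nhds
  · filter_upwards [key b c h, hpos] with ε h1 h2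
    nlinarith [mul_pos h2 h1]
  · filter_upwards [hpos] with ε h2
    positivity

/-- Lexicographic positivity of a triple of reals: `a + ε b + ε² c > 0` for small `ε > 0`. -/
def LexPos (a b c : ℝ) : Prop := 0 < a ∨ (a = 0 ∧ (0 < b ∨ (b = 0 ∧ 0 < c)))

theorem lexPos_or_neg {a b c : ℝ} (h : b ≠ 0 ∨ c ≠ 0) : LexPos a b c ∨ LexPos (-a) (-b) (-c) := by
  unfold LexPos
  rcases lt_trichotomy a 0 with ha | ha | ha <;> rcases lt_trichotomy b 0 with hb | hb | hb <;>
    rcases lt_trichotomy c 0 with hc | hc | hc <;> simp_all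

/-- The vertices of a triangle as an affine basis of the plane. -/
noncomputable def triBasis (t : Affine.Triangle ℝ ℂ) : AffineBasis (Fin 3) ℝ ℂ :=
  ⟨t.points, t.independent, by
    rw [t.independent.affineSpan_eq_top_iff_card_eq_finrank_add_one]
    simp [Complex.finrank_real_complex]⟩

/-- Barycentric coordinates with respect to a triangle. -/
noncomputable def bary (t : Affine.Triangle ℝ ℂ) (k : Fin 3) : ℂ →ᵃ[ℝ] ℝ := (triBasis t).coord k

theorem mem_triangleRegion {t : Affine.Triangle ℝ ℂ} {x : ℂ} :
    x ∈ triangleRegion t ↔ ∀ k, 0 ≤ bary t k x := by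
  have := (triBasis t).convexHull_eq_nonneg_coord
  exact Set.ext_iff.1 this x

theorem mem_interior_triangleRegion {t : Affine.Triangle ℝ ℂ} {x : ℂ} :
    x ∈ interior (triangleRegion t) ↔ ∀ k, 0 < bary t k x := by
  have := (triBasis t).interior_convexHull
  exact Set.ext_iff.1 this x

theorem bary_points (t : Affine.Triangle ℝ ℂ) (k l : Fin 3) :
    bary t k (t.points l) = if k = l then 1 else 0 :=
  (triBasis t).coord_apply k l

theorem bary_add (t : Affine.Triangle ℝ ℂ) (k : Fin 3) (x w : ℂ) :
    bary t k (x + w) = bary t k x + (bary t k).linear w := by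
  have := (bary t k).map_vadd x w
  rw [vadd_eq_add, vadd_eq_add] at this
  rw [add_comm, this, add_comm]

theorem bary_linear_sub (t : Affine.Triangle ℝ ℂ) (k : Fin 3) (x y : ℂ) :
    (bary t k).linear (x - y) = bary t k x - bary t k y := by
  have := bary_add t k y (x - y)
  rw [add_sub_cancel] at this
  linarith

theorem sum_bary (t : Affine.Triangle ℝ ℂ) (x : ℂ) :
    bary t 0 x + bary t 1 x + bary t 2 x = 1 := by
  have := (triBasis t).sum_coord_apply_eq_one x
  rwa [Fin.sum_univ_three] at this

theorem sum_bary_smul (t : Affine.Triangle ℝ ℂ) (x : ℂ) :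
    bary t 0 x • t.points 0 + bary t 1 x • t.points 1 + bary t 2 x • t.points 2 = x := by
  have := (triBasis t).linear_combination_coord_eq_self x
  rwa [Fin.sum_univ_three] at this

theorem sum_bary_linear (t : Affine.Triangle ℝ ℂ) (w : ℂ) :
    (bary t 0).linear w + (bary t 1).linear w + (bary t 2).linear w = 0 := by
  have h1 := sum_bary t w
  have h2 := sum_bary t 0
  have h3 := bary_linear_sub t 0 w 0
  have h4 := bary_linear_sub t 1 w 0
  have h5 := bary_linear_sub t 2 w 0
  rw [sub_zero] at h3 h4 h5
  linarith

theorem sum_bary_linear_smul (t : Affine.Triangle ℝ ℂ) (w : ℂ) :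
    (bary t 0).linear w • t.points 0 + (bary t 1).linear w • t.points 1 +
      (bary t 2).linear w • t.points 2 = w := by
  have h1 := sum_bary_smul t w
  have h2 := sum_bary_smul t 0
  have h3 := bary_linear_sub t 0 w 0
  have h4 := bary_linear_sub t 1 w 0
  have h5 := bary_linear_sub t 2 w 0
  rw [sub_zero] at h3 h4 h5
  rw [h3, h4, h5]
  simp only [sub_smul]
  linear_combination h1 - h2

/-- A real linear functional vanishing at `w ≠ 0` and `I * w` vanishes. -/
theorem linear_eq_zero_of_rotate {f : ℂ →ₗ[ℝ] ℝ} {w : ℂ} (hw : w ≠ 0) (h1 : f w = 0)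
    (h2 : f (Complex.I * w) = 0) (z : ℂ) : f z = 0 := by
  have hz : z = (z / w).re • w + (z / w).im • (Complex.I * w) := by
    rw [Complex.real_smul, Complex.real_smul]
    have : z = (((z / w).re : ℂ) + ((z / w).im : ℂ) * Complex.I) * w := by
      rw [Complex.re_add_im]; field_simp
    linear_combination this
  rw [hz, map_add, map_smul, map_smul, h1, h2]; simp

/-- A direction and its quarter turn cannot both be parallel to the same side. Hence the curve x +
εw + ε²(iw) leaves every side line at once, and for small ε it is strictly inside or strictly
outside each triangle. -/
theorem bary_linear_ne_zero (t : Affine.Triangle ℝ ℂ) (k : Fin 3) {w : ℂ} (hw : w ≠ 0) :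
    (bary t k).linear w ≠ 0 ∨ (bary t k).linear (Complex.I * w) ≠ 0 := by
  by_contra! h
  have := linear_eq_zero_of_rotate hw h.1 h.2 (t.points k - t.points (k + 1))
  rw [bary_linear_sub, bary_points, bary_points] at this
  fin_cases k <;> simp at this

/-- The triangle `t` contains `x + ε w + ε² w'` for all small `ε > 0`. -/
def HasGerm (t : Affine.Triangle ℝ ℂ) (x w w' : ℂ) : Prop :=
  ∀ k, LexPos (bary t k x) ((bary t k).linear w) ((bary t k).linear w')

theorem bary_germ (t : Affine.Triangle ℝ ℂ) (k : Fin 3) (x w w' : ℂ) (ε : ℝ) :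
    bary t k (x + (ε • w + ε ^ 2 • w')) =
      bary t k x + (ε * (bary t k).linear w + ε ^ 2 * (bary t k).linear w') := by
  rw [bary_add, map_add, map_smul, map_smul, smul_eq_mul, smul_eq_mul]

open Filter Topology in
theorem HasGerm.eventually {t : Affine.Triangle ℝ ℂ} {x w w' : ℂ} (h : HasGerm t x w w') :
    ∀ᶠ ε : ℝ in 𝓝[>] 0, x + (ε • w + ε ^ 2 • w') ∈ interior (triangleRegion t) := by
  simp only [mem_interior_triangleRegion, eventually_all, bary_germ]
  exact fun k => lex_eventually_pos (h k)

open Filter Topology in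
theorem eventually_notMem_of_not_germ {t : Affine.Triangle ℝ ℂ} {x w w' : ℂ}
    (hw : ∀ k, (bary t k).linear w ≠ 0 ∨ (bary t k).linear w' ≠ 0) (h : ¬ HasGerm t x w w') :
    ∀ᶠ ε : ℝ in 𝓝[>] 0, x + (ε • w + ε ^ 2 • w') ∉ triangleRegion t := by
  unfold HasGerm at h
  push Not at h
  obtain ⟨k, hk⟩ := h
  have h2 := lex_eventually_pos ((lexPos_or_neg (hw k)).resolve_left hk)
  filter_upwards [h2] with ε hε hmem
  have := mem_triangleRegion.1 hmem k
  rw [bary_germ] at this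
  linarith

open Classical in
/-- Indicator of `HasGerm`. -/
noncomputable def germInd (t : Affine.Triangle ℝ ℂ) (x w w' : ℂ) : ℝ :=
  if HasGerm t x w w' then 1 else 0

-- The source of every additivity statement below. For small ε the moving point is interior to a
-- triangle or outside it, and disjoint interiors allow at most one triangle to contain it. The
-- right side mentions only P, so two tilings of P have equal germ counts.
open Filter Topology Classical in
theorem sum_germInd {ι : Type*} [Fintype ι] {T : ι → Affine.Triangle ℝ ℂ} {P : Set ℂ}
    (hU : (⋃ i, triangleRegion (T i)) = P)
    (hD : ∀ i j, i ≠ j → Disjoint (interior (triangleRegion (T i))) (interior (triangleRegion (T j))))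
    {x w w' : ℂ}
    (hw : ∀ t : Affine.Triangle ℝ ℂ, ∀ k, (bary t k).linear w ≠ 0 ∨ (bary t k).linear w' ≠ 0) :
    ∑ i, germInd (T i) x w w' =
      if ∀ᶠ ε : ℝ in 𝓝[>] 0, x + (ε • w + ε ^ 2 • w') ∈ P then 1 else 0 := by
  by_cases h : ∃ i, HasGerm (T i) x w w'
  · obtain ⟨i, hi⟩ := h
    rw [if_pos, Finset.sum_eq_single i]
    · simp [germInd, hi]
    · intro j _ hj
      rw [germInd, if_neg]
      intro hj'
      obtain ⟨ε, h1, h2⟩ := (hi.eventually.and hj'.eventually).exists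
      exact Set.disjoint_left.1 (hD i j hj.symm) h1 h2
    · simp
    · filter_upwards [hi.eventually] with ε hε
      rw [← hU]
      exact Set.mem_iUnion.2 ⟨i, interior_subset hε⟩
  · push Not at h
    rw [if_neg, Finset.sum_eq_zero]
    · intro i _
      rw [germInd, if_neg (h i)]
    · intro hP
      have := eventually_all.2 fun i => eventually_notMem_of_not_germ (hw (T i)) (h i)
      obtain ⟨ε, h1, h2⟩ := (hP.and this).exists
      rw [← hU] at h1
      obtain ⟨i, hi⟩ := Set.mem_iUnion.1 h1
      exact h2 i hi

/-! ### Angles measured as areas in the unit disc -/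

-- Polar coordinates. Reading angles as areas makes angle sums at a point into integrals of germ
-- indicators, with no need to order the triangles around the point.
open MeasureTheory in
theorem volume_sector {θ : ℝ} (hπ : θ < π) :
    volume {z : ℂ | z ∈ Metric.ball (0 : ℂ) 1 ∧ 0 < z.arg ∧ z.arg < θ} = ENNReal.ofReal (θ / 2) := by
  set S := {z : ℂ | z ∈ Metric.ball (0 : ℂ) 1 ∧ 0 < z.arg ∧ z.arg < θ} with hS
  have hm : MeasurableSet S := by
    apply MeasurableSet.inter measurableSet_ball
    exact (measurableSet_lt measurable_const Complex.measurable_arg).inter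
      (measurableSet_lt Complex.measurable_arg measurable_const)
  rw [← lintegral_indicator_one hm, ← Complex.lintegral_comp_polarCoord_symm]
  have hR : MeasurableSet (Set.Ioo (0 : ℝ) 1 ×ˢ Set.Ioo 0 θ) := measurableSet_Ioo.prod measurableSet_Ioo
  have h1 : ∫⁻ p in polarCoord.target, ENNReal.ofReal p.1 • S.indicator 1 (Complex.polarCoord.symm p)
      = ∫⁻ p in Set.Ioo (0 : ℝ) 1 ×ˢ Set.Ioo 0 θ, ENNReal.ofReal p.1 := by
    rw [← lintegral_indicator polarCoord.open_target.measurableSet, ← lintegral_indicator hR]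
    congr 1
    ext ⟨r, φ⟩
    simp only [Set.indicator_apply, polarCoord_target, Set.mem_prod, Set.mem_Ioi, Set.mem_Ioo]
    by_cases hp : 0 < r ∧ -π < φ ∧ φ < π
    · rw [if_pos hp]
      have harg : (Complex.polarCoord.symm (r, φ)).arg = φ := by
        rw [Complex.polarCoord_symm_apply]
        simpa using Complex.arg_mul_cos_add_sin_mul_I hp.1 ⟨hp.2.1, hp.2.2.le⟩
      have hn : ‖Complex.polarCoord.symm (r, φ)‖ = r := by
        rw [Complex.norm_polarCoord_symm, abs_of_pos hp.1]
      have : Complex.polarCoord.symm (r, φ) ∈ S ↔ (0 < r ∧ r < 1) ∧ 0 < φ ∧ φ < θ := by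
        rw [hS, Set.mem_ofPred_eq, harg, mem_ball_zero_iff, hn]
        tauto
      by_cases hin : (0 < r ∧ r < 1) ∧ 0 < φ ∧ φ < θ
      · rw [if_pos hin, Set.indicator_of_mem (this.2 hin)]
        simp
      · rw [if_neg hin, Set.indicator_of_notMem (fun h => hin (this.1 h))]
        simp
    · rw [if_neg hp, if_neg]
      rintro ⟨⟨a, _⟩, b, c⟩
      exact hp ⟨a, by linarith, by linarith⟩
  rw [h1, Measure.volume_eq_prod, ← Measure.prod_restrict, lintegral_prod _ (by fun_prop)]
  simp only [lintegral_const, Measure.restrict_apply MeasurableSet.univ, Set.univ_inter,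
    Real.volume_Ioo, sub_zero]
  rw [lintegral_mul_const _ (by fun_prop), ← ofReal_integral_eq_lintegral_ofReal,
    ← integral_Ioc_eq_integral_Ioo, ← intervalIntegral.integral_of_le zero_le_one, integral_id,
    ← ENNReal.ofReal_mul (by norm_num)]
  · congr 1; ring
  · exact (continuous_id.integrableOn_Icc).mono_set Set.Ioo_subset_Icc_self
  · filter_upwards [ae_restrict_mem measurableSet_Ioo] with x hx using hx.1.le

open InnerProductGeometry in
/-- Two linearly independent vectors can be moved by a linear isometry so that the first one is
a positive real number and the second one lies in the upper half plane. -/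
theorem exists_isometry_normalize {p q : ℂ} (h : (q / p).im ≠ 0) :
    ∃ e : ℂ ≃ₗᵢ[ℝ] ℂ, e p = (‖p‖ : ℂ) ∧ 0 < (e q).im := by
  have hp : p ≠ 0 := by rintro rfl; simp at h
  have hp' : (‖p‖ : ℂ) ≠ 0 := by simpa using hp
  let a : Circle := ⟨‖p‖ / p, by simp [Submonoid.unitSphere, hp]⟩
  have ha : ∀ z, rotation a z = ‖p‖ / p * z := fun z => rotation_apply a z
  have hq : rotation a q = ‖p‖ * (q / p) := by rw [ha]; ring
  have hpp : rotation a p = ‖p‖ := by rw [ha]; field_simp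
  have him : (rotation a q).im = ‖p‖ * (q / p).im := by rw [hq]; simp
  rcases lt_or_gt_of_ne h with h | h
  · refine ⟨(rotation a).trans Complex.conjLIE, by simp [hpp], ?_⟩
    simp only [LinearIsometryEquiv.trans_apply, Complex.conjLIE_apply, Complex.conj_im, him]
    nlinarith [norm_pos_iff.2 hp]
  · refine ⟨rotation a, hpp, ?_⟩
    rw [him]
    exact mul_pos (norm_pos_iff.2 hp) h

-- An isometry puts p on the positive real axis and q in the upper half plane, at argument θ. Then g
-- has the sign of Im (e w), and f that of sin(θ - arg (e w)), so the cone becomes the sector 0 <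
-- arg < θ.
open MeasureTheory in
theorem volume_cone {p q : ℂ} {f g : ℂ → ℝ} (hfg : ∀ w, w = f w • p + g w • q)
    (h : (q / p).im ≠ 0) :
    volume {w : ℂ | w ∈ Metric.ball (0 : ℂ) 1 ∧ 0 < f w ∧ 0 < g w} =
      ENNReal.ofReal (InnerProductGeometry.angle p q / 2) := by
  obtain ⟨e, hep, heq⟩ := exists_isometry_normalize h
  have hp : p ≠ 0 := by rintro rfl; simp at h
  have hpn : 0 < ‖p‖ := norm_pos_iff.2 hp
  set θ := (e q).arg with hθ
  have hq0 : e q ≠ 0 := by intro h0; rw [h0] at heq; simp at heq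
  have hang : InnerProductGeometry.angle p q = θ := by
    have h1 : InnerProductGeometry.angle (e p) (e q) = InnerProductGeometry.angle p q :=
      e.toLinearIsometry.angle_map p q
    rw [← h1, hep, InnerProductGeometry.angle_comm,
      Complex.angle_eq_abs_arg hq0 (by simpa using hp), div_eq_inv_mul, ← Complex.ofReal_inv,
      Complex.arg_real_mul _ (inv_pos.2 hpn), abs_of_nonneg (Complex.arg_nonneg_iff.2 heq.le)]
  have hθ0 : 0 < θ := by
    refine lt_of_le_of_ne (Complex.arg_nonneg_iff.2 heq.le) fun h0 => ?_
    have := Complex.norm_mul_sin_arg (e q)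
    rw [← hθ, ← h0, sin_zero] at this
    linarith
  have hθπ : θ < π := Complex.arg_lt_pi_iff.2 (Or.inr heq.ne')
  rw [hang, ← volume_sector hθπ,
    ← e.measurePreserving.measure_preimage_equiv (f := e.toMeasurableEquiv)
      {z : ℂ | z ∈ Metric.ball (0 : ℂ) 1 ∧ 0 < z.arg ∧ z.arg < θ}]
  congr 1
  ext w
  simp only [Set.mem_preimage, Set.mem_ofPred_eq, mem_ball_zero_iff]
  have hew : e w = f w * ‖p‖ + g w * e q := by
    conv_lhs => rw [hfg w]
    rw [map_add, map_smul, map_smul, hep, Complex.real_smul, Complex.real_smul]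
  have him : (e w).im = g w * (e q).im := by rw [hew]; simp
  have hre : (e w).re = f w * ‖p‖ + g w * (e q).re := by rw [hew]; simp
  have hf : f w * (‖p‖ * (e q).im) = ‖e w‖ * ‖e q‖ * sin (θ - (e w).arg) := by
    rw [sin_sub]
    have h1 := Complex.norm_mul_cos_arg (e w)
    have h2 := Complex.norm_mul_sin_arg (e w)
    have h3 := Complex.norm_mul_cos_arg (e q)
    have h4 := Complex.norm_mul_sin_arg (e q)
    rw [← hθ] at h3 h4
    have : ‖e w‖ * ‖e q‖ * (sin θ * cos (e w).arg - cos θ * sin (e w).arg)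
      = (‖e w‖ * cos (e w).arg) * (‖e q‖ * sin θ) - (‖e q‖ * cos θ) * (‖e w‖ * sin (e w).arg) := by
      ring
    rw [this, h1, h2, h3, h4, him, hre]
    ring
  have hee : ‖e.toMeasurableEquiv w‖ = ‖w‖ := e.norm_map w
  have hea : e.toMeasurableEquiv w = e w := rfl
  rw [hee, hea]
  refine and_congr_right fun _ => ?_
  have hqn : 0 < ‖e q‖ := norm_pos_iff.2 hq0
  constructor
  · rintro ⟨h1, h2⟩
    have hpos : 0 < (e w).im := by rw [him]; positivity
    have ha0 : 0 ≤ (e w).arg := Complex.arg_nonneg_iff.2 hpos.le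
    have ha1 : (e w).arg < π := Complex.arg_lt_pi_iff.2 (Or.inr hpos.ne')
    refine ⟨lt_of_le_of_ne ha0 fun h0 => ?_, ?_⟩
    · have := Complex.norm_mul_sin_arg (e w)
      rw [← h0, sin_zero] at this
      linarith
    · by_contra! hle
      have : sin (θ - (e w).arg) ≤ 0 := by
        rw [← neg_sub, sin_neg]
        exact neg_nonpos.2 (sin_nonneg_of_nonneg_of_le_pi (by linarith) (by linarith))
      have h3 : 0 < f w * (‖p‖ * (e q).im) := by positivity
      rw [hf] at h3
      have h4 : 0 ≤ ‖e w‖ * ‖e q‖ := by positivity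
      nlinarith [mul_nonneg h4 (neg_nonneg.2 this)]
  · rintro ⟨h1, h2⟩
    have hw0 : 0 < ‖e w‖ := by
      refine norm_pos_iff.2 fun h0 => ?_
      rw [h0] at h1; simp at h1
    have hpos : 0 < (e w).im := by
      rw [← Complex.norm_mul_sin_arg]
      exact mul_pos hw0 (sin_pos_of_pos_of_lt_pi h1 (by linarith))
    constructor
    · have h3 : 0 < ‖e w‖ * ‖e q‖ * sin (θ - (e w).arg) :=
        mul_pos (mul_pos hw0 hqn) (sin_pos_of_pos_of_lt_pi (by linarith) (by linarith))
      rw [← hf] at h3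
      exact pos_of_mul_pos_left h3 (by positivity)
    · rw [him] at hpos
      exact pos_of_mul_pos_left hpos heq.le

theorem fin_three_sum_cyclic {M : Type*} [AddCommMonoid M] (f : Fin 3 → M) (i : Fin 3) :
    f i + f (i + 1) + f (i + 2) = f 0 + f 1 + f 2 := by
  fin_cases i
  · rfl
  · change f 1 + f 2 + f 0 = _
    abel
  · change f 2 + f 0 + f 1 = _
    abel

theorem fin_three_ne (i : Fin 3) :
    i + 1 ≠ i ∧ i + 2 ≠ i ∧ i + 1 ≠ i + 2 ∧ i + 2 ≠ i + 1 := by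
  revert i; decide

theorem fin_three_cases (i k : Fin 3) : k = i ∨ k = i + 1 ∨ k = i + 2 := by
  revert i k; decide

theorem bary_linear_continuous (t : Affine.Triangle ℝ ℂ) (k : Fin 3) :
    Continuous (bary t k).linear := LinearMap.continuous_of_finiteDimensional _

theorem measurableSet_hasGerm (t : Affine.Triangle ℝ ℂ) (x : ℂ) :
    MeasurableSet {w : ℂ | HasGerm t x w (Complex.I * w)} := by
  have h1 : ∀ k, Measurable fun w : ℂ => (bary t k).linear w := fun k =>
    (bary_linear_continuous t k).measurable
  have h2 : ∀ k, Measurable fun w : ℂ => (bary t k).linear (Complex.I * w) := fun k =>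
    (h1 k).comp (measurable_const_mul _)
  have h3 : ∀ k, MeasurableSet {w : ℂ | LexPos (bary t k x) ((bary t k).linear w)
      ((bary t k).linear (Complex.I * w))} := by
    intro k
    unfold LexPos
    refine MeasurableSet.union (MeasurableSet.const _) (MeasurableSet.inter (MeasurableSet.const _)
      (MeasurableSet.union (measurableSet_lt measurable_const (h1 k)) (MeasurableSet.inter
        (measurableSet_eq_fun (h1 k) measurable_const) (measurableSet_lt measurable_const (h2 k)))))
  have : {w : ℂ | HasGerm t x w (Complex.I * w)} = ⋂ k, {w : ℂ | LexPos (bary t k x)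
      ((bary t k).linear w) ((bary t k).linear (Complex.I * w))} := by
    ext w; simp [HasGerm]
  rw [this]
  exact MeasurableSet.iInter h3

open MeasureTheory in
/-- The angle under which the triangle `t` is seen from `x` (locally at `x`). -/
noncomputable def localAngle (t : Affine.Triangle ℝ ℂ) (x : ℂ) : ℝ :=
  2 * ∫ w in Metric.ball (0 : ℂ) 1, germInd t x w (Complex.I * w)

open MeasureTheory in
theorem localAngle_eq_volume (t : Affine.Triangle ℝ ℂ) (x : ℂ) :
    localAngle t x =
      2 * (volume {w : ℂ | w ∈ Metric.ball (0 : ℂ) 1 ∧ HasGerm t x w (Complex.I * w)}).toReal := by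
  have : (fun w => germInd t x w (Complex.I * w)) =
      {w : ℂ | HasGerm t x w (Complex.I * w)}.indicator 1 := by
    ext w
    by_cases h : HasGerm t x w (Complex.I * w) <;>
      simp [germInd, Set.indicator, h]
  rw [localAngle, this, integral_indicator_one (measurableSet_hasGerm t x), measureReal_def,
    Measure.restrict_apply (measurableSet_hasGerm t x), Set.inter_comm]
  rfl

open MeasureTheory in
theorem integrableOn_germInd (t : Affine.Triangle ℝ ℂ) (x : ℂ) :
    IntegrableOn (fun w => germInd t x w (Complex.I * w)) (Metric.ball (0 : ℂ) 1) := by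
  have : (fun w => germInd t x w (Complex.I * w)) =
      {w : ℂ | HasGerm t x w (Complex.I * w)}.indicator (fun _ => (1 : ℝ)) := by
    ext w
    by_cases h : HasGerm t x w (Complex.I * w) <;>
      simp [germInd, Set.indicator, h]
  rw [this]
  exact (integrableOn_const (by simp)).indicator (measurableSet_hasGerm t x)

-- The integral does not involve the triangles, which allows the angle sums of a tiling to be
-- replaced by those of the fan.
open MeasureTheory Filter Topology Classical in
theorem sum_localAngle_eq_integral {ι : Type*} [Fintype ι] {T : ι → Affine.Triangle ℝ ℂ} {P : Set ℂ}
    (hU : (⋃ i, triangleRegion (T i)) = P)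
    (hD : ∀ i j, i ≠ j → Disjoint (interior (triangleRegion (T i))) (interior (triangleRegion (T j))))
    (x : ℂ) :
    ∑ i, localAngle (T i) x = 2 * ∫ w in Metric.ball (0 : ℂ) 1,
      if ∀ᶠ ε : ℝ in 𝓝[>] 0, x + (ε • w + ε ^ 2 • (Complex.I * w)) ∈ P then (1 : ℝ) else 0 := by
  simp only [localAngle]
  rw [← Finset.mul_sum, ← integral_finsetSum _ fun i _ => integrableOn_germInd (T i) x]
  congr 1
  refine integral_congr_ae ?_
  have h0 : ∀ᵐ w ∂(volume.restrict (Metric.ball (0 : ℂ) 1)), w ≠ 0 :=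
    ae_restrict_of_ae (by simp [ae_iff])
  filter_upwards [h0] with w hw
  exact sum_germInd hU hD fun t k => bary_linear_ne_zero t k hw

open MeasureTheory in
theorem sum_localAngle_le {ι : Type*} [Fintype ι] {T : ι → Affine.Triangle ℝ ℂ}
    (hD : ∀ i j, i ≠ j → Disjoint (interior (triangleRegion (T i))) (interior (triangleRegion (T j))))
    (x : ℂ) : ∑ i, localAngle (T i) x ≤ 2 * π := by
  rw [sum_localAngle_eq_integral rfl hD]
  have h1 : (volume.real (Metric.ball (0 : ℂ) 1)) = π := by simp [measureReal_def]
  gcongr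
  rw [← h1]
  refine (integral_mono_of_nonneg (g := fun _ => (1 : ℝ)) ?_ (integrableOn_const (by simp)) ?_).trans_eq
    (by simp [measureReal_def])
  · filter_upwards with w
    simp only [Pi.zero_apply]; split_ifs <;> norm_num
  · filter_upwards with w
    split_ifs <;> norm_num

open MeasureTheory in
theorem ae_linear_ne_zero {f : ℂ →ₗ[ℝ] ℝ} (hf : f ≠ 0) : ∀ᵐ w : ℂ, f w ≠ 0 := by
  have : volume (LinearMap.ker f : Set ℂ) = 0 := by
    apply Measure.addHaar_submodule
    rwa [ne_eq, LinearMap.ker_eq_top]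
  rw [ae_iff]
  convert this using 2
  ext w
  simp

theorem bary_linear_ne_zero' (t : Affine.Triangle ℝ ℂ) (k : Fin 3) : (bary t k).linear ≠ 0 := by
  intro h
  rcases bary_linear_ne_zero t k one_ne_zero with h1 | h1 <;> exact h1 (by rw [h]; rfl)

theorem bary_points_self (t : Affine.Triangle ℝ ℂ) (k : Fin 3) : bary t k (t.points k) = 1 := by
  simp [bary_points]

theorem bary_points_succ (t : Affine.Triangle ℝ ℂ) (k : Fin 3) :
    bary t (k + 1) (t.points k) = 0 := by
  rw [bary_points, if_neg]; revert k; decide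

theorem bary_points_succ_succ (t : Affine.Triangle ℝ ℂ) (k : Fin 3) :
    bary t (k + 2) (t.points k) = 0 := by
  rw [bary_points, if_neg]; revert k; decide

theorem eq_bary_linear_smul (t : Affine.Triangle ℝ ℂ) (i : Fin 3) (w : ℂ) :
    w = (bary t (i + 1)).linear w • (t.points (i + 1) - t.points i) +
      (bary t (i + 2)).linear w • (t.points (i + 2) - t.points i) := by
  have h1 := sum_bary_linear_smul t w
  rw [← fin_three_sum_cyclic (fun k => (bary t k).linear w • t.points k) i] at h1
  have h2 := sum_bary_linear t w
  rw [← fin_three_sum_cyclic (fun k => (bary t k).linear w) i] at h2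
  have h3 : (bary t i).linear w = -(bary t (i + 1)).linear w - (bary t (i + 2)).linear w := by
    linarith
  rw [h3] at h1
  conv_lhs => rw [← h1]
  module

theorem side_div_im_ne_zero (t : Affine.Triangle ℝ ℂ) (i : Fin 3) :
    ((t.points (i + 2) - t.points i) / (t.points (i + 1) - t.points i)).im ≠ 0 := by
  intro h
  set p := t.points (i + 1) - t.points i with hp
  set q := t.points (i + 2) - t.points i with hq
  have hp0 : p ≠ 0 := by
    rw [hp, sub_ne_zero]
    intro h
    exact (fin_three_ne i).1 (t.independent.injective h)
  have hqp : q = (q / p).re • p := by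
    rw [Complex.real_smul]
    have : ((q / p).re : ℂ) = q / p := Complex.ext (by simp) (by simp [h])
    rw [this]; field_simp
  have h1 : (bary t (i + 2)).linear q = 1 := by
    rw [hq, bary_linear_sub, bary_points_self, bary_points_succ_succ, sub_zero]
  have h2 : (bary t (i + 2)).linear p = 0 := by
    rw [hp, bary_linear_sub, bary_points_succ_succ, bary_points, if_neg (fin_three_ne i).2.2.2, sub_zero]
  rw [hqp, map_smul, h2] at h1
  simp at h1

theorem lexPos_zero_iff {b c : ℝ} (hb : b ≠ 0) : LexPos 0 b c ↔ 0 < b := by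
  simp [LexPos, hb]

theorem lexPos_of_pos {a b c : ℝ} (h : 0 < a) : LexPos a b c := Or.inl h

theorem not_lexPos_of_neg {a b c : ℝ} (h : a < 0) : ¬ LexPos a b c := by
  rintro (h' | ⟨h', _⟩) <;> linarith

-- Up to the null set of directions along the two sides at the vertex, germs staying in the triangle
-- form the open cone spanned by these sides.
open MeasureTheory in
theorem localAngle_vertex (t : Affine.Triangle ℝ ℂ) (i : Fin 3) :
    localAngle t (t.points i) = triangleAngle t i := by
  have h := volume_cone (eq_bary_linear_smul t i) (side_div_im_ne_zero t i)
  have h2 : {w : ℂ | w ∈ Metric.ball (0 : ℂ) 1 ∧ HasGerm t (t.points i) w (Complex.I * w)} =ᵐ[volume]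
      {w : ℂ | w ∈ Metric.ball (0 : ℂ) 1 ∧ 0 < (bary t (i + 1)).linear w ∧
        0 < (bary t (i + 2)).linear w} := by
    filter_upwards [ae_linear_ne_zero (bary_linear_ne_zero' t (i + 1)),
      ae_linear_ne_zero (bary_linear_ne_zero' t (i + 2))] with w h1 h2
    refine propext (and_congr_right fun _ => ?_)
    constructor
    · intro hg
      have g1 := hg (i + 1)
      have g2 := hg (i + 2)
      rw [bary_points_succ, lexPos_zero_iff h1] at g1
      rw [bary_points_succ_succ, lexPos_zero_iff h2] at g2
      exact ⟨g1, g2⟩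
    · rintro ⟨g1, g2⟩ k
      rcases fin_three_cases i k with rfl | rfl | rfl
      · exact lexPos_of_pos (by rw [bary_points_self]; exact one_pos)
      · rwa [bary_points_succ, lexPos_zero_iff h1]
      · rwa [bary_points_succ_succ, lexPos_zero_iff h2]
  rw [localAngle_eq_volume, measure_congr h2, h, ENNReal.toReal_ofReal
    (by have := InnerProductGeometry.angle_nonneg (t.points (i + 1) - t.points i)
          (t.points (i + 2) - t.points i); positivity)]
  rw [triangleAngle, EuclideanGeometry.angle]
  simp only [vsub_eq_sub]
  ring

-- The map w ↦ -w exchanges the two halves, and the dividing line is null.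
open MeasureTheory in
theorem volume_half_disc {f : ℂ →ₗ[ℝ] ℝ} (hf : f ≠ 0) :
    (volume {w : ℂ | w ∈ Metric.ball (0 : ℂ) 1 ∧ 0 < f w}).toReal = π / 2 := by
  have hfm : Measurable f := (LinearMap.continuous_of_finiteDimensional f).measurable
  set A := {w : ℂ | w ∈ Metric.ball (0 : ℂ) 1 ∧ 0 < f w} with hA
  set B := {w : ℂ | w ∈ Metric.ball (0 : ℂ) 1 ∧ f w < 0} with hB
  have hBm : MeasurableSet B := measurableSet_ball.inter (measurableSet_lt hfm measurable_const)
  have hAB : volume A = volume B := by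
    rw [← Measure.measure_neg volume A]
    congr 1
    ext w
    simp [hA, hB]
  have hU : (A ∪ B : Set ℂ) =ᵐ[volume] Metric.ball (0 : ℂ) 1 := by
    filter_upwards [ae_linear_ne_zero hf] with w hw
    refine propext ⟨?_, fun h => ?_⟩
    · rintro (h | h) <;> exact h.1
    · rcases lt_or_gt_of_ne hw with h' | h'
      · exact Or.inr ⟨h, h'⟩
      · exact Or.inl ⟨h, h'⟩
  have hd : Disjoint A B := Set.disjoint_left.2 fun w h1 h2 => lt_asymm h1.2 h2.2
  have h1 := measure_union (μ := volume) hd hBm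
  rw [measure_congr hU, ← hAB, Complex.volume_ball] at h1
  have h2 := congrArg ENNReal.toReal h1
  have hfin : volume A ≠ ⊤ :=
    ((measure_mono (fun w hw => hw.1)).trans_lt (measure_ball_lt_top (x := (0 : ℂ)) (r := 1))).ne
  rw [ENNReal.toReal_add hfin hfin] at h2
  simp at h2
  linarith

open MeasureTheory in
theorem localAngle_eq_zero_of_notMem {t : Affine.Triangle ℝ ℂ} {x : ℂ} (hx : x ∉ triangleRegion t) :
    localAngle t x = 0 := by
  rw [mem_triangleRegion] at hx
  push Not at hx
  obtain ⟨k, hk⟩ := hx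
  have : {w : ℂ | w ∈ Metric.ball (0 : ℂ) 1 ∧ HasGerm t x w (Complex.I * w)} = ∅ := by
    ext w
    simp only [Set.mem_ofPred_eq, Set.mem_empty_iff_false, iff_false, not_and]
    exact fun _ h => not_lexPos_of_neg hk (h k)
  rw [localAngle_eq_volume, this]
  rw [measure_empty, ENNReal.toReal_zero, mul_zero]

-- The three values belong to a point outside, in the relative interior of a side, and in the
-- interior. In the second case the other two coordinates are positive, since otherwise the point
-- would be a vertex.
open MeasureTheory in
theorem localAngle_of_ne_vertex (t : Affine.Triangle ℝ ℂ) (x : ℂ) (hx : ∀ i, x ≠ t.points i) :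
    localAngle t x = 0 ∨ localAngle t x = π ∨ localAngle t x = 2 * π := by
  by_cases hneg : ∃ k, bary t k x < 0
  · exact Or.inl (localAngle_eq_zero_of_notMem (by simpa [mem_triangleRegion] using hneg))
  push Not at hneg
  rw [localAngle_eq_volume]
  by_cases hpos : ∀ k, 0 < bary t k x
  · right; right
    have : {w : ℂ | w ∈ Metric.ball (0 : ℂ) 1 ∧ HasGerm t x w (Complex.I * w)} =
        Metric.ball (0 : ℂ) 1 := by
      ext w
      exact ⟨fun h => h.1, fun h => ⟨h, fun k => lexPos_of_pos (hpos k)⟩⟩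
    rw [this]
    simp
  push Not at hpos
  obtain ⟨k, hk⟩ := hpos
  have hk0 : bary t k x = 0 := le_antisymm hk (hneg k)
  right; left
  have hs := sum_bary t x
  rw [← fin_three_sum_cyclic (fun k => bary t k x) k] at hs
  have hss := sum_bary_smul t x
  rw [← fin_three_sum_cyclic (fun k => bary t k x • t.points k) k] at hss
  simp only [hk0, zero_add, zero_smul] at hs hss
  have h1 : 0 < bary t (k + 1) x := by
    refine lt_of_le_of_ne (hneg _) fun h => hx (k + 2) ?_
    rw [← h, zero_add] at hs
    rw [← h, hs] at hss
    simpa using hss.symm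
  have h2 : 0 < bary t (k + 2) x := by
    refine lt_of_le_of_ne (hneg _) fun h => hx (k + 1) ?_
    rw [← h, add_zero] at hs
    rw [← h, hs] at hss
    simpa using hss.symm
  have hae : {w : ℂ | w ∈ Metric.ball (0 : ℂ) 1 ∧ HasGerm t x w (Complex.I * w)} =ᵐ[volume]
      {w : ℂ | w ∈ Metric.ball (0 : ℂ) 1 ∧ 0 < (bary t k).linear w} := by
    filter_upwards [ae_linear_ne_zero (bary_linear_ne_zero' t k)] with w hw
    refine propext (and_congr_right fun _ => ?_)
    constructor
    · intro hg
      have g1 := hg k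
      rwa [hk0, lexPos_zero_iff hw] at g1
    · intro g l
      rcases fin_three_cases k l with rfl | rfl | rfl
      · rwa [hk0, lexPos_zero_iff hw]
      · exact lexPos_of_pos h1
      · exact lexPos_of_pos h2
  rw [measure_congr hae, volume_half_disc (bary_linear_ne_zero' t k)]
  ring

/-! ### The fan triangulation of a regular polygon -/

/-- The point of the unit circle with argument `d π / n`. -/
noncomputable def unitPt (n : ℕ) (d : ℤ) : ℂ := Complex.exp ((d * π / n : ℝ) * Complex.I)

theorem unitPt_add (n : ℕ) (a b : ℤ) : unitPt n (a + b) = unitPt n a * unitPt n b := by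
  rw [unitPt, unitPt, unitPt, ← Complex.exp_add]
  congr 1
  push_cast
  ring

theorem unitPt_zero (n : ℕ) : unitPt n 0 = 1 := by simp [unitPt]

theorem unitPt_ne_zero (n : ℕ) (a : ℤ) : unitPt n a ≠ 0 := Complex.exp_ne_zero _

theorem conj_unitPt (n : ℕ) (a : ℤ) : (starRingEnd ℂ) (unitPt n a) = unitPt n (-a) := by
  rw [unitPt, unitPt, ← Complex.exp_conj]
  congr 1
  rw [map_mul, Complex.conj_I, Complex.conj_ofReal]
  push_cast
  ring

theorem unitPt_re (n : ℕ) (a : ℤ) : (unitPt n a).re = cos (a * π / n) := by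
  rw [unitPt, Complex.exp_ofReal_mul_I_re]

theorem unitPt_im (n : ℕ) (a : ℤ) : (unitPt n a).im = sin (a * π / n) := by
  rw [unitPt, Complex.exp_ofReal_mul_I_im]

theorem norm_unitPt (n : ℕ) (a : ℤ) : ‖unitPt n a‖ = 1 := by
  rw [unitPt, Complex.norm_exp_ofReal_mul_I]

theorem unitPt_two_mul_self {n : ℕ} (hn : n ≠ 0) (a : ℤ) : unitPt n (2 * n * a) = 1 := by
  rw [unitPt, Complex.exp_eq_one_iff]
  refine ⟨a, ?_⟩
  have : (n : ℂ) ≠ 0 := by exact_mod_cast hn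
  push_cast
  field_simp

theorem unitPt_emod {n : ℕ} (hn : n ≠ 0) (a b : ℤ) :
    unitPt n (2 * (a % n) + b) = unitPt n (2 * a + b) := by
  have h : 2 * a + b = (2 * (a % n) + b) + 2 * n * (a / n) := by
    have := Int.emod_add_mul_ediv a n
    linear_combination (-2) * this
  rw [h, unitPt_add _ (2 * (a % n) + b), unitPt_two_mul_self hn, mul_one]

theorem cos_mul_pi_div_le {n : ℕ} (hn : 3 ≤ n) {d : ℤ} (h0 : d ≠ 0) (h1 : |d| ≤ 2 * n - 1) :
    cos (d * π / n) ≤ cos (1 * π / n) := by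
  have hn0 : (0 : ℝ) < n := by positivity
  have hc : cos (d * π / n) = cos ((|d| : ℤ) * π / n) := by
    rw [← Real.cos_abs, abs_div, abs_mul, abs_of_pos hn0, abs_of_pos pi_pos, Int.cast_abs]
  have hd1 : (1 : ℝ) ≤ (|d| : ℤ) := by exact_mod_cast Int.one_le_abs h0
  have hd2 : ((|d| : ℤ) : ℝ) ≤ 2 * n - 1 := by exact_mod_cast h1
  rw [hc]
  generalize ((|d| : ℤ) : ℝ) = x at hd1 hd2
  have hpi := pi_pos
  rcases le_total x n with h | h
  · apply cos_le_cos_of_nonneg_of_le_pi (by positivity)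
    · rw [div_le_iff₀ hn0]; nlinarith
    · gcongr
  · have : cos (x * π / n) = cos ((2 * n - x) * π / n) := by
      rw [← cos_two_pi_sub]; congr 1; field_simp
    rw [this]
    apply cos_le_cos_of_nonneg_of_le_pi (by positivity)
    · rw [div_le_iff₀ hn0]; nlinarith
    · gcongr; linarith

theorem cos_mul_pi_div_lt {n : ℕ} (hn : 3 ≤ n) {d : ℤ} (h0 : 1 < |d|) (h1 : |d| < 2 * n - 1) :
    cos (d * π / n) < cos (1 * π / n) := by
  have hn0 : (0 : ℝ) < n := by positivity
  have hc : cos (d * π / n) = cos ((|d| : ℤ) * π / n) := by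
    rw [← Real.cos_abs, abs_div, abs_mul, abs_of_pos hn0, abs_of_pos pi_pos, Int.cast_abs]
  have hd1 : (1 : ℝ) < (|d| : ℤ) := by exact_mod_cast h0
  have hd2 : ((|d| : ℤ) : ℝ) < 2 * n - 1 := by exact_mod_cast h1
  rw [hc]
  generalize ((|d| : ℤ) : ℝ) = x at hd1 hd2
  have hpi := pi_pos
  rcases le_total x n with h | h
  · apply cos_lt_cos_of_nonneg_of_le_pi (by positivity)
    · rw [div_le_iff₀ hn0]; nlinarith
    · gcongr
  · have : cos (x * π / n) = cos ((2 * n - x) * π / n) := by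
      rw [← cos_two_pi_sub]; congr 1; field_simp
    rw [this]
    apply cos_lt_cos_of_nonneg_of_le_pi (by positivity)
    · rw [div_le_iff₀ hn0]; nlinarith
    · gcongr; linarith

theorem cos_pi_div_pos {n : ℕ} (hn : 3 ≤ n) : 0 < cos (1 * π / n) := by
  have hn0 : (3 : ℝ) ≤ n := by exact_mod_cast hn
  have hpi := pi_pos
  apply cos_pos_of_mem_Ioo
  constructor
  · have : 0 ≤ 1 * π / n := by positivity
    linarith
  · rw [div_lt_iff₀ (by linarith)]; nlinarith

theorem sin_two_pi_div_pos {n : ℕ} (hn : 3 ≤ n) : 0 < sin (2 * π / n) := by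
  have hn0 : (3 : ℝ) ≤ n := by exact_mod_cast hn
  have hpi := pi_pos
  apply sin_pos_of_pos_of_lt_pi (by positivity)
  rw [div_lt_iff₀ (by linarith)]; nlinarith

/-- Coordinate of `z` in the direction of argument `(2 j + 1) π / n`. -/
noncomputable def sectorHeight (n : ℕ) (z : ℂ) (j : ℤ) : ℝ := (z * unitPt n (-(2 * j + 1))).re

theorem sectorHeight_add_smul (n : ℕ) (s t : ℝ) (k j : ℤ) :
    sectorHeight n (s * unitPt n (2 * k) + t * unitPt n (2 * (k + 1))) j =
      s * cos ((2 * (k - j) - 1 : ℤ) * π / n) + t * cos ((2 * (k - j) + 1 : ℤ) * π / n) := by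
  rw [sectorHeight, add_mul, mul_assoc, mul_assoc, ← unitPt_add, ← unitPt_add, Complex.add_re,
    Complex.re_ofReal_mul, Complex.re_ofReal_mul, unitPt_re, unitPt_re]
  congr 5 <;> · push_cast; ring

theorem sectorHeight_self (n : ℕ) (s t : ℝ) (k : ℤ) :
    sectorHeight n (s * unitPt n (2 * k) + t * unitPt n (2 * (k + 1))) k =
      (s + t) * cos (1 * π / n) := by
  rw [sectorHeight_add_smul]
  have : cos ((2 * (k - k) - 1 : ℤ) * π / n) = cos (1 * π / n) := by
    rw [← cos_neg]; congr 1; push_cast; ring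
  rw [this]
  have : cos ((2 * (k - k) + 1 : ℤ) * π / n) = cos (1 * π / n) := by
    congr 1; push_cast; ring
  rw [this]; ring

/-- Among the bisectors of the sectors, a point of an open sector projects furthest onto its own.
This replaces any discussion of arguments when sectors are separated. -/
theorem sectorHeight_lt {n : ℕ} (hn : 3 ≤ n) {s t : ℝ} (hs : 0 < s) (ht : 0 < t) {k j : Fin n}
    (hkj : k ≠ j) :
    sectorHeight n (s * unitPt n (2 * (k : ℕ)) + t * unitPt n (2 * ((k : ℕ) + 1))) (j : ℕ) <
      (s + t) * cos (1 * π / n) := by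
  rw [sectorHeight_add_smul]
  have hk := k.2
  have hj := j.2
  have hne : (k : ℕ) ≠ j := fun h => hkj (Fin.ext h)
  generalize hd : ((k : ℕ) : ℤ) - (j : ℕ) = d
  have hdn : |d| < n ∧ d ≠ 0 := by rw [abs_lt]; omega
  have h1 : cos ((2 * d - 1 : ℤ) * π / n) ≤ cos (1 * π / n) := by
    apply cos_mul_pi_div_le hn (by omega)
    rw [abs_lt] at hdn; rw [abs_le]; omega
  have h2 : cos ((2 * d + 1 : ℤ) * π / n) ≤ cos (1 * π / n) := by
    apply cos_mul_pi_div_le hn (by omega)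
    rw [abs_lt] at hdn; rw [abs_le]; omega
  rw [add_mul]
  -- One of the two cosine inequalities is strict: both odd numbers could be among ±1, ±(2n - 1)
  -- only for d = 0 or n = 2.
  have hcases : (1 < |2 * d - 1| ∧ |2 * d - 1| < 2 * n - 1) ∨
      (1 < |2 * d + 1| ∧ |2 * d + 1| < 2 * n - 1) := by
    rw [abs_lt] at hdn
    simp only [abs_lt, lt_abs]
    omega
  rcases hcases with ⟨a, b⟩ | ⟨a, b⟩
  · have := cos_mul_pi_div_lt hn a b
    have := mul_lt_mul_of_pos_left this hs
    have := mul_le_mul_of_nonneg_left h2 ht.le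
    linarith
  · have := cos_mul_pi_div_lt hn a b
    have := mul_lt_mul_of_pos_left this ht
    have := mul_le_mul_of_nonneg_left h1 hs.le
    linarith

/-- Every point of the plane lies in one of the `n` closed sectors. -/
theorem exists_sector {n : ℕ} (hn : 3 ≤ n) (z : ℂ) : ∃ k : Fin n, ∃ s t : ℝ, 0 ≤ s ∧ 0 ≤ t ∧
    z = s * unitPt n (2 * (k : ℕ)) + t * unitPt n (2 * ((k : ℕ) + 1)) := by
  have hn0 : n ≠ 0 := by omega
  have : Nonempty (Fin n) := ⟨⟨0, by omega⟩⟩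
  -- The right sector is the one whose bisector gives the largest projection. Comparison with the
  -- bisectors k + 1 and k - 1 forces s ≥ 0 and t ≥ 0 respectively.
  obtain ⟨k, hk⟩ := Finite.exists_max fun k : Fin n => sectorHeight n z (k : ℕ)
  have hmax : ∀ j : ℤ, sectorHeight n z j ≤ sectorHeight n z (k : ℕ) := by
    intro j
    have hj0 := Int.emod_nonneg j (by exact_mod_cast hn0 : (n : ℤ) ≠ 0)
    have hj1 := Int.emod_lt_of_pos j (by omega : (0 : ℤ) < n)
    refine le_of_eq_of_le ?_ (hk ⟨(j % n).toNat, by omega⟩)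
    simp only [sectorHeight]
    rw [Int.toNat_of_nonneg hj0, ← conj_unitPt, ← conj_unitPt, unitPt_emod hn0]
  set y := z * unitPt n (-(2 * (k : ℕ))) with hy
  set t := y.im / sin (2 * π / n) with ht
  set s := y.re - t * cos (2 * π / n) with hs
  have hyst : y = s + t * unitPt n 2 := by
    have h0 := (sin_two_pi_div_pos hn).ne'
    apply Complex.ext
    · simp only [Complex.add_re, Complex.ofReal_re, Complex.re_ofReal_mul, unitPt_re, hs]
      push_cast
      ring
    · simp only [Complex.add_im, Complex.ofReal_im, Complex.im_ofReal_mul, unitPt_im, zero_add]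
      rw [ht]
      push_cast
      field_simp
  have hz : z = s * unitPt n (2 * (k : ℕ)) + t * unitPt n (2 * ((k : ℕ) + 1)) := by
    have h1 : z = y * unitPt n (2 * (k : ℕ)) := by
      rw [hy, mul_assoc, ← unitPt_add, neg_add_cancel, unitPt_zero, mul_one]
    rw [h1, hyst, mul_add, unitPt_add, mul_one]
    ring
  have hc3 : cos ((3 : ℤ) * π / n) < cos (1 * π / n) :=
    cos_mul_pi_div_lt hn (by norm_num) (by rw [abs_lt]; omega)
  have hself := sectorHeight_self n s t (k : ℕ)
  have e1 := sectorHeight_add_smul n s t (k : ℕ) ((k : ℕ) + 1)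
  have e2 := sectorHeight_add_smul n s t (k : ℕ) ((k : ℕ) - 1)
  have m1 := hmax ((k : ℕ) + 1)
  have m2 := hmax ((k : ℕ) - 1)
  rw [← hz] at hself e1 e2
  have a1 : cos ((2 * (((k : ℕ) : ℤ) - ((k : ℕ) + 1)) - 1 : ℤ) * π / n) = cos ((3 : ℤ) * π / n) := by
    rw [← cos_neg]; congr 1; push_cast; ring
  have a2 : cos ((2 * (((k : ℕ) : ℤ) - ((k : ℕ) + 1)) + 1 : ℤ) * π / n) = cos (1 * π / n) := by
    rw [← cos_neg]; congr 1; push_cast; ring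
  have a3 : cos ((2 * (((k : ℕ) : ℤ) - ((k : ℕ) - 1)) - 1 : ℤ) * π / n) = cos (1 * π / n) := by
    congr 1; push_cast; ring
  have a4 : cos ((2 * (((k : ℕ) : ℤ) - ((k : ℕ) - 1)) + 1 : ℤ) * π / n) = cos ((3 : ℤ) * π / n) := by
    congr 1; push_cast; ring
  rw [a1, a2] at e1
  rw [a3, a4] at e2
  refine ⟨k, s, t, ?_, ?_, hz⟩
  · by_contra! h
    nlinarith [mul_pos_of_neg_of_neg h (sub_neg.2 hc3)]
  · by_contra! h
    nlinarith [mul_pos_of_neg_of_neg h (sub_neg.2 hc3)]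

theorem affineIndependent_of_im_ne_zero {a b c : ℂ} (h : ((c - a) / (b - a)).im ≠ 0) :
    AffineIndependent ℝ ![a, b, c] := by
  rw [affineIndependent_iff_not_collinear_set, collinear_iff_of_mem (p₀ := a) (by simp)]
  rintro ⟨v, hv⟩
  obtain ⟨x, hx⟩ := hv b (by simp)
  obtain ⟨y, hy⟩ := hv c (by simp)
  apply h
  rw [hx, hy]
  simp only [Complex.real_smul, vadd_eq_add, add_sub_cancel_right]
  by_cases hv0 : v = 0
  · simp [hv0]
  · rw [mul_div_mul_right _ _ hv0, ← Complex.ofReal_div, Complex.ofReal_im]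

/-- The `k`-th vertex of a regular polygon. -/
noncomputable def polyVertex (c r : ℂ) (n : ℕ) (k : ℤ) : ℂ := c + r * unitPt n (2 * k)

theorem fan_independent {n : ℕ} (hn : 3 ≤ n) {c r : ℂ} (hr : r ≠ 0) (k : ℤ) :
    AffineIndependent ℝ ![c, polyVertex c r n k, polyVertex c r n (k + 1)] := by
  apply affineIndependent_of_im_ne_zero
  rw [polyVertex, polyVertex, add_sub_cancel_left, add_sub_cancel_left, mul_div_mul_left _ _ hr,
    mul_add, unitPt_add, mul_div_cancel_left₀ _ (unitPt_ne_zero _ _), unitPt_im]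
  have := sin_two_pi_div_pos hn
  push_cast
  exact this.ne'

/-- The `k`-th triangle of the fan of a regular polygon from its centre. -/
noncomputable def fanTriangle {n : ℕ} (hn : 3 ≤ n) (c : ℂ) {r : ℂ} (hr : r ≠ 0) (k : Fin n) :
    Affine.Triangle ℝ ℂ :=
  ⟨![c, polyVertex c r n (k : ℕ), polyVertex c r n ((k : ℕ) + 1)], fan_independent hn hr _⟩

section fan

variable {n : ℕ} (hn : 3 ≤ n) (c : ℂ) {r : ℂ} (hr : r ≠ 0) (k : Fin n)

theorem fanTriangle_zero : (fanTriangle hn c hr k).points 0 = c := rfl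

theorem fanTriangle_one : (fanTriangle hn c hr k).points 1 = polyVertex c r n (k : ℕ) := rfl

theorem fanTriangle_two : (fanTriangle hn c hr k).points 2 = polyVertex c r n ((k : ℕ) + 1) := rfl

theorem eq_fan_coords (z : ℂ) : z = c + r * (bary (fanTriangle hn c hr k) 1 z * unitPt n (2 * (k : ℕ)) +
    bary (fanTriangle hn c hr k) 2 z * unitPt n (2 * ((k : ℕ) + 1))) := by
  have h1 := sum_bary_smul (fanTriangle hn c hr k) z
  have h2 : bary (fanTriangle hn c hr k) 0 z =
    1 - bary (fanTriangle hn c hr k) 1 z - bary (fanTriangle hn c hr k) 2 z := by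
    linarith [sum_bary (fanTriangle hn c hr k) z]
  rw [fanTriangle_zero, fanTriangle_one, fanTriangle_two, h2] at h1
  simp only [Complex.real_smul, polyVertex] at h1
  conv_lhs => rw [← h1]
  push_cast
  ring

theorem mem_fanTriangle {s t : ℝ} (hs : 0 ≤ s) (ht : 0 ≤ t) (hst : s + t ≤ 1) :
    c + r * (s * unitPt n (2 * (k : ℕ)) + t * unitPt n (2 * ((k : ℕ) + 1))) ∈
      triangleRegion (fanTriangle hn c hr k) := by
  have hconv := convex_convexHull ℝ (Set.range (fanTriangle hn c hr k).points)
  have := hconv.sum_mem (t := Finset.univ) (w := ![1 - s - t, s, t])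
    (z := (fanTriangle hn c hr k).points) (fun i _ => by
      fin_cases i
      · change 0 ≤ 1 - s - t
        linarith
      · exact hs
      · exact ht) (by rw [Fin.sum_univ_three]; change 1 - s - t + s + t = 1; ring)
    (fun i _ => subset_convexHull _ _ (Set.mem_range_self i))
  rw [Fin.sum_univ_three, fanTriangle_zero, fanTriangle_one, fanTriangle_two] at this
  simp only [Matrix.cons_val_zero, Matrix.cons_val_one, Matrix.cons_val, Complex.real_smul,
    polyVertex] at this
  rw [triangleRegion]
  convert this using 1
  push_cast
  ring

/-- At a common interior point the heights along the two bisectors would each be strictly less than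
the other. -/
theorem fan_disjoint (j : Fin n) (hkj : k ≠ j) :
    Disjoint (interior (triangleRegion (fanTriangle hn c hr k)))
      (interior (triangleRegion (fanTriangle hn c hr j))) := by
  rw [Set.disjoint_left]
  intro z h1 h2
  rw [mem_interior_triangleRegion] at h1 h2
  have e1 := eq_fan_coords hn c hr k z
  have e2 := eq_fan_coords hn c hr j z
  have l1 := sectorHeight_lt hn (h1 1) (h1 2) hkj
  have l2 := sectorHeight_lt hn (h2 1) (h2 2) hkj.symm
  have s1 := sectorHeight_self n (bary (fanTriangle hn c hr k) 1 z)
    (bary (fanTriangle hn c hr k) 2 z) (k : ℕ)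
  have s2 := sectorHeight_self n (bary (fanTriangle hn c hr j) 1 z)
    (bary (fanTriangle hn c hr j) 2 z) (j : ℕ)
  have := mul_left_cancel₀ hr (add_left_cancel (e1.symm.trans e2))
  rw [this] at l1 s1
  linarith

theorem fan_iUnion : (⋃ k, triangleRegion (fanTriangle hn c hr k)) =
    convexHull ℝ (Set.range fun k : Fin n => polyVertex c r n (k : ℕ)) := by
  have hn0 : n ≠ 0 := by omega
  apply Set.Subset.antisymm
  · apply Set.iUnion_subset
    intro k
    have hv : ∀ j : ℤ, polyVertex c r n j ∈
        convexHull ℝ (Set.range fun k : Fin n => polyVertex c r n (k : ℕ)) := by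
      intro j
      have hj0 := Int.emod_nonneg j (by exact_mod_cast hn0 : (n : ℤ) ≠ 0)
      have hj1 := Int.emod_lt_of_pos j (by omega : (0 : ℤ) < n)
      apply subset_convexHull
      refine ⟨⟨(j % n).toNat, by omega⟩, ?_⟩
      simp only [polyVertex]
      rw [Int.toNat_of_nonneg hj0]
      have := unitPt_emod hn0 j 0
      rw [add_zero, add_zero] at this
      rw [this]
    -- The centre is the mean of the vertices, because the n-th roots of unity sum to zero.
    have hc : c ∈ convexHull ℝ (Set.range fun k : Fin n => polyVertex c r n (k : ℕ)) := by
      have h := (convex_convexHull ℝ (Set.range fun k : Fin n => polyVertex c r n (k : ℕ))).sum_mem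
        (t := Finset.univ) (w := fun _ : Fin n => (1 : ℝ) / n)
        (z := fun k : Fin n => polyVertex c r n (k : ℕ)) (fun _ _ => by positivity)
        (by simp; field_simp) (fun i _ => hv _)
      have hsum : ∑ k : Fin n, unitPt n (2 * (k : ℕ)) = 0 := by
        have hp := (Complex.isPrimitiveRoot_exp n hn0).geom_sum_eq_zero (by omega)
        rw [← Fin.sum_univ_eq_sum_range] at hp
        rw [← hp]
        refine Finset.sum_congr rfl fun k _ => ?_
        rw [← Complex.exp_nat_mul, unitPt]
        congr 1
        push_cast
        ring
      convert h using 1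
      simp only [polyVertex, Complex.real_smul]
      rw [← Finset.mul_sum, Finset.sum_add_distrib, ← Finset.mul_sum, hsum]
      have : (n : ℂ) ≠ 0 := by exact_mod_cast hn0
      simp
      field_simp
    apply convexHull_min _ (convex_convexHull _ _)
    rintro _ ⟨i, rfl⟩
    fin_cases i
    · exact hc
    · exact hv _
    · exact hv _
  · intro z hz
    obtain ⟨k, s, t, hs, ht, hzst⟩ := exists_sector hn ((z - c) / r)
    have hz' : z = c + r * (s * unitPt n (2 * (k : ℕ)) + t * unitPt n (2 * ((k : ℕ) + 1))) := by
      rw [← hzst]; field_simp; ring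
    -- The polygon lies in the half plane bounded by the line of its k-th side; this gives s + t ≤
    -- 1.
    have hbound : sectorHeight n ((z - c) / r) (k : ℕ) ≤ cos (1 * π / n) := by
      have hlin : IsLinearMap ℝ fun z : ℂ => (z / r * unitPt n (-(2 * (k : ℕ) + 1))).re :=
        ⟨fun x y => by rw [← Complex.add_re]; congr 1; ring, fun a x => by
          rw [Complex.real_smul, smul_eq_mul, ← Complex.re_ofReal_mul]; congr 1; ring⟩
      have hconv := convex_halfSpace_le hlin
        (cos (1 * π / n) + (c / r * unitPt n (-(2 * (k : ℕ) + 1))).re)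
      have hsub := convexHull_min (s := Set.range fun k : Fin n => polyVertex c r n (k : ℕ)) (by
        rintro _ ⟨j, rfl⟩
        have hexp : polyVertex c r n (j : ℕ) / r * unitPt n (-(2 * (k : ℕ) + 1)) =
            unitPt n (2 * ((j : ℕ) - (k : ℕ)) - 1) + c / r * unitPt n (-(2 * (k : ℕ) + 1)) := by
          have : (2 * ((j : ℕ) - (k : ℕ)) - 1 : ℤ) = 2 * (j : ℕ) + (-(2 * (k : ℕ) + 1)) := by ring
          rw [this, unitPt_add, polyVertex]
          field_simp
          ring
        rw [Set.mem_ofPred_eq, hexp, Complex.add_re, unitPt_re]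
        gcongr
        have hk := k.2
        have hj := j.2
        apply cos_mul_pi_div_le hn (by omega)
        rw [abs_le]; omega) hconv hz
      rw [Set.mem_ofPred_eq] at hsub
      rw [sectorHeight, sub_div, sub_mul, Complex.sub_re]
      linarith
    rw [hzst, sectorHeight_self] at hbound
    have hst : s + t ≤ 1 := by
      have := cos_pi_div_pos hn
      by_contra! h
      nlinarith
    refine Set.mem_iUnion.2 ⟨k, ?_⟩
    rw [hz']
    exact mem_fanTriangle hn c hr k hs ht hst

end fan

section fan

variable {n : ℕ} (hn : 3 ≤ n) (c : ℂ) {r : ℂ} (hr : r ≠ 0) (k : Fin n)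

theorem dist_center_polyVertex (j : ℤ) : dist c (polyVertex c r n j) = ‖r‖ := by
  rw [polyVertex, dist_self_add_right, norm_mul, norm_unitPt, mul_one]

theorem fan_angle_center : triangleAngle (fanTriangle hn c hr k) 0 = 2 * π / n := by
  change ∠ (polyVertex c r n (k : ℕ)) c (polyVertex c r n ((k : ℕ) + 1)) = _
  have hn0 : (3 : ℝ) ≤ n := by exact_mod_cast hn
  have hpi := pi_pos
  have h2 : 2 * π / n ≤ π := by rw [div_le_iff₀ (by linarith)]; nlinarith
  have h0 : 0 ≤ 2 * π / n := by positivity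
  rw [EuclideanGeometry.angle, polyVertex, polyVertex, vsub_eq_sub, vsub_eq_sub,
    add_sub_cancel_left, add_sub_cancel_left, Complex.angle_mul_left hr, mul_add, unitPt_add]
  nth_rw 1 [← mul_one (unitPt n (2 * (k : ℕ)))]
  rw [Complex.angle_mul_left (unitPt_ne_zero _ _), Complex.angle_one_left (unitPt_ne_zero _ _),
    unitPt]
  rw [Complex.arg_exp_mul_I, (toIocMod_eq_self _).2]
  · push_cast
    exact abs_of_nonneg h0
  · push_cast
    constructor <;> linarith

theorem fan_points_ne (i j : Fin 3) (hij : i ≠ j) :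
    (fanTriangle hn c hr k).points i ≠ (fanTriangle hn c hr k).points j :=
  fun h => hij ((fanTriangle hn c hr k).independent.injective h)

theorem fan_angle_base :
    triangleAngle (fanTriangle hn c hr k) 1 = π / 2 - π / n ∧
      triangleAngle (fanTriangle hn c hr k) 2 = π / 2 - π / n := by
  have h0 := fan_angle_center hn c hr k
  change ∠ (polyVertex c r n (k : ℕ)) c (polyVertex c r n ((k : ℕ) + 1)) = _ at h0
  change ∠ (polyVertex c r n ((k : ℕ) + 1)) (polyVertex c r n (k : ℕ)) c = _ ∧
    ∠ c (polyVertex c r n ((k : ℕ) + 1)) (polyVertex c r n (k : ℕ)) = _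
  have hiso : ∠ c (polyVertex c r n (k : ℕ)) (polyVertex c r n ((k : ℕ) + 1)) =
      ∠ c (polyVertex c r n ((k : ℕ) + 1)) (polyVertex c r n (k : ℕ)) :=
    angle_eq_angle_of_dist_eq (by rw [dist_center_polyVertex, dist_center_polyVertex])
  have hne := fan_points_ne hn c hr k 1 0 (by decide)
  have hsum := angle_add_angle_add_angle_eq_pi (p₁ := c) (p₂ := polyVertex c r n (k : ℕ))
    (polyVertex c r n ((k : ℕ) + 1)) hne
  rw [angle_comm (polyVertex c r n ((k : ℕ) + 1)) c, h0] at hsum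
  rw [angle_comm (polyVertex c r n ((k : ℕ) + 1))]
  have e1 : 2 * π / n = 2 * (π / n) := by ring
  rw [e1] at hsum
  rw [angle_comm (polyVertex c r n (k : ℕ)) (polyVertex c r n ((k : ℕ) + 1))] at hsum
  constructor <;> linarith

/-- In the scaled coordinate a polygon vertex has norm 1, whereas a point with weights s, t has
squared norm (s + t)² - 2st(1 - cos(2π/n)). With s + t ≤ 1 this is 1 only if st = 0 and s + t = 1.
-/
theorem eq_vertex_of_mem_fanTriangle (j : ℤ)
    (h : polyVertex c r n j ∈ triangleRegion (fanTriangle hn c hr k)) :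
    polyVertex c r n j = polyVertex c r n (k : ℕ) ∨
      polyVertex c r n j = polyVertex c r n ((k : ℕ) + 1) := by
  rw [mem_triangleRegion] at h
  have e := eq_fan_coords hn c hr k (polyVertex c r n j)
  have hsum := sum_bary (fanTriangle hn c hr k) (polyVertex c r n j)
  have h0 := h 0
  have hs := h 1
  have ht := h 2
  generalize bary (fanTriangle hn c hr k) 1 (polyVertex c r n j) = s at e hs hsum
  generalize bary (fanTriangle hn c hr k) 2 (polyVertex c r n j) = t at e ht hsum
  have hst : s + t ≤ 1 := by linarith
  rw [polyVertex] at e ⊢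
  have e2 := mul_left_cancel₀ hr (add_left_cancel e)
  have e3 : unitPt n (2 * j) = unitPt n (2 * (k : ℕ)) * (s + t * unitPt n 2) := by
    rw [e2, mul_add 2, unitPt_add, mul_one]; ring
  have hnorm : Complex.normSq (s + t * unitPt n 2) = 1 := by
    have := congrArg (fun z => ‖z‖) e3
    simp only [norm_mul, norm_unitPt, one_mul] at this
    rw [Complex.normSq_eq_norm_sq, ← this, one_pow]
  have hcos : cos ((2 : ℤ) * π / n) < 1 := by
    have h1 := sin_two_pi_div_pos hn
    have h2 := sin_sq_add_cos_sq (2 * π / n)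
    push_cast
    nlinarith
  rw [Complex.normSq_apply] at hnorm
  simp only [Complex.add_re, Complex.add_im, Complex.ofReal_re, Complex.ofReal_im,
    Complex.re_ofReal_mul, Complex.im_ofReal_mul, unitPt_re, unitPt_im, zero_add] at hnorm
  have hq := sin_sq_add_cos_sq ((2 : ℤ) * π / n)
  have hnorm' : (s + t) ^ 2 - 2 * (s * t * (1 - cos ((2 : ℤ) * π / n))) = 1 := by
    linear_combination hnorm - t ^ 2 * hq
  have hst0 : s * t * (1 - cos ((2 : ℤ) * π / n)) = 0 := by
    apply le_antisymm
    · nlinarith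
    · exact mul_nonneg (mul_nonneg hs ht) (by linarith)
  have hst1 : s * t = 0 := (mul_eq_zero.1 hst0).resolve_right (by linarith)
  have hsq : (s + t) ^ 2 = 1 := by linarith
  have hone : s + t = 1 := by nlinarith
  rcases mul_eq_zero.1 hst1 with h | h
  · right
    have ht1 : t = 1 := by linarith
    rw [e2, h, ht1, polyVertex]
    simp
  · left
    have hs1 : s = 1 := by linarith
    rw [e2, h, hs1, polyVertex]
    simp

theorem localAngle_fan_vertex (j : ℤ) :
    localAngle (fanTriangle hn c hr k) (polyVertex c r n j) =
      (if polyVertex c r n (k : ℕ) = polyVertex c r n j then π / 2 - π / n else 0) +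
      (if polyVertex c r n ((k : ℕ) + 1) = polyVertex c r n j then π / 2 - π / n else 0) := by
  have hne : polyVertex c r n (k : ℕ) ≠ polyVertex c r n ((k : ℕ) + 1) :=
    fan_points_ne hn c hr k 1 2 (by decide)
  by_cases h1 : polyVertex c r n (k : ℕ) = polyVertex c r n j
  · rw [if_pos h1, if_neg (fun h => hne (h1.trans h.symm)), add_zero, ← h1, ← fanTriangle_one hn c hr,
      localAngle_vertex, (fan_angle_base hn c hr k).1]
  · by_cases h2 : polyVertex c r n ((k : ℕ) + 1) = polyVertex c r n j
    · rw [if_pos h2, if_neg h1, zero_add, ← h2, ← fanTriangle_two hn c hr,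
        localAngle_vertex, (fan_angle_base hn c hr k).2]
    · rw [if_neg h1, if_neg h2, add_zero]
      apply localAngle_eq_zero_of_notMem
      intro h
      rcases eq_vertex_of_mem_fanTriangle hn c hr k j h with h | h
      · exact h1 h.symm
      · exact h2 h.symm

include hn hr in
theorem polyVertex_eq_iff (a b : ℤ) : polyVertex c r n a = polyVertex c r n b ↔ (n : ℤ) ∣ a - b := by
  have hn0 : n ≠ 0 := by omega
  have hnc : (n : ℂ) ≠ 0 := by exact_mod_cast hn0
  rw [polyVertex, polyVertex, add_right_inj, mul_right_inj' hr, unitPt, unitPt,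
    Complex.exp_eq_exp_iff_exists_int]
  have hpi : (π : ℂ) ≠ 0 := by exact_mod_cast pi_ne_zero
  refine exists_congr fun q => ?_
  push_cast
  constructor
  · intro h
    have h2 : (a : ℂ) = b + n * q := by
      field_simp at h
      linear_combination h
    have h3 : a = b + n * q := by exact_mod_cast h2
    linarith
  · intro h
    have h2 : (a : ℂ) = b + n * q := by
      have : a = b + n * q := by linarith
      exact_mod_cast this
    rw [h2]
    field_simp

theorem card_fin_dvd_sub {n : ℕ} (hn : n ≠ 0) (b : ℤ) (A : ℝ) [∀ k : Fin n, Decidable ((n : ℤ) ∣ (k : ℕ) - b)] :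
    ∑ k : Fin n, (if (n : ℤ) ∣ (k : ℕ) - b then A else 0) = A := by
  have hj0 := Int.emod_nonneg b (by exact_mod_cast hn : (n : ℤ) ≠ 0)
  have hj1 := Int.emod_lt_of_pos b (by omega : (0 : ℤ) < n)
  rw [Finset.sum_eq_single (⟨(b % n).toNat, by omega⟩ : Fin n)]
  · rw [if_pos]
    simp only [Int.toNat_of_nonneg hj0]
    rw [Int.emod_def]
    exact ⟨-(b / n), by ring⟩
  · intro k _ hk
    rw [if_neg]
    intro h
    apply hk
    ext
    have h2 := Int.emod_emod_of_dvd b (dvd_refl (n : ℤ))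
    have h3 : ((k : ℕ) : ℤ) % n = b % n := Int.emod_eq_emod_iff_emod_sub_eq_zero.2
      (Int.emod_eq_zero_of_dvd h)
    rw [Int.emod_eq_of_lt (by omega) (by have := k.2; omega)] at h3
    simp only
    omega
  · simp

theorem sum_localAngle_fan_vertex (j : ℤ) :
    ∑ k, localAngle (fanTriangle hn c hr k) (polyVertex c r n j) = π - 2 * π / n := by
  simp only [localAngle_fan_vertex]
  rw [Finset.sum_add_distrib]
  have h2 : ∀ k : Fin n, (((k : ℕ) : ℤ) + 1 - j) = (k : ℕ) - (j - 1) := fun k => by ring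
  simp only [polyVertex_eq_iff hn c hr, h2]
  rw [card_fin_dvd_sub (by omega), card_fin_dvd_sub (by omega)]
  ring

/-- At the centre n angles 2π/n meet. At any other point each fan triangle contributes 0, π or 2π,
and the total is at most 2π. -/
theorem sum_localAngle_fan_other (x : ℂ) (hx : ∀ j : ℤ, x ≠ polyVertex c r n j) :
    ∃ N : ℕ, N ≤ 2 ∧ ∑ k, localAngle (fanTriangle hn c hr k) x = N * π := by
  have hn0 : (n : ℝ) ≠ 0 := by positivity
  by_cases hxc : x = c
  · refine ⟨2, le_rfl, ?_⟩
    have : ∀ k, localAngle (fanTriangle hn c hr k) x = 2 * π / n := by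
      intro k
      rw [hxc, ← fan_angle_center hn c hr k]
      exact localAngle_vertex (fanTriangle hn c hr k) 0
    simp only [this]
    simp
    field_simp
  · have h : ∀ k, ∃ N : ℕ, localAngle (fanTriangle hn c hr k) x = N * π := by
      intro k
      rcases localAngle_of_ne_vertex (fanTriangle hn c hr k) x (by
        intro i
        fin_cases i
        · exact hxc
        · exact hx _
        · exact hx _) with h | h | h
      · exact ⟨0, by simp [h]⟩
      · exact ⟨1, by simp [h]⟩
      · exact ⟨2, by simp [h]⟩
    choose N hN using h
    have hle := sum_localAngle_le (fan_disjoint hn c hr) x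
    have hs : ∑ k, localAngle (fanTriangle hn c hr k) x = (∑ k, N k : ℕ) * π := by
      simp only [hN]
      rw [← Finset.sum_mul]
      push_cast
      rfl
    refine ⟨∑ k, N k, ?_, hs⟩
    rw [hs] at hle
    have := le_of_mul_le_mul_right hle pi_pos
    exact_mod_cast this

end fan

/-! ### Arithmetic of the angle equations -/

/-- Here f ≥ 4 would give f(n + 4) ≥ 52 > 48 ≥ 12w, so f is 1, 2 or 3. With n ≥ 9 and w ≤ 4 this
leaves n = 20, 32, 44 for f = 1, n = 14, 20 for f = 2 and n = 12 for f = 3, all of them excluded. -/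
theorem not_mul_add_four_eq {n f w d : ℤ} (hn : 9 ≤ n)
    (hn' : n ≠ 12 ∧ n ≠ 14 ∧ n ≠ 20 ∧ n ≠ 32 ∧ n ≠ 44) (hd : 1 ≤ d) (hw : w ≤ 4)
    (hf : f = 3 * w - d) : f * (n + 4) ≠ 12 * w := by
  intro h
  have hf3 : f ≤ 3 := by
    by_contra! hf3
    have := mul_le_mul (show (4 : ℤ) ≤ f by omega) (show (13 : ℤ) ≤ n + 4 by omega) (by norm_num)
      (by omega)
    omega
  have hw1 : 1 ≤ w := by
    by_contra! hw0
    have h1 := mul_nonneg (show 0 ≤ 3 * w - 1 - f by omega) (show 0 ≤ n + 4 by omega)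
    have h2 := mul_nonneg (show 0 ≤ 1 - 3 * w by omega) (show 0 ≤ n - 9 by omega)
    nlinarith
  have hf1 : 1 ≤ f := by
    by_contra! hf0
    have h1 := mul_nonneg (show 0 ≤ -f by omega) (show 0 ≤ n + 4 by omega)
    nlinarith
  interval_cases f <;> omega

/-- The bounds give a ≤ 4, b ≤ 8 and, from Kn = 4b and n ≥ 9, also 1 ≤ K ≤ 3, so only finitely many
cases remain. The stray solution 3/7 comes from K = 1, g = 1, d = 2. -/
theorem small_fraction_arithmetic {n a K : ℤ} {b d g : ℕ} (hn : 9 ≤ n)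
    (hn' : n ≠ 12 ∧ n ≠ 14 ∧ n ≠ 20 ∧ n ≠ 32 ∧ n ≠ 44) (ha : 1 ≤ a) (hab : 2 * a ≤ b)
    (hba : b ≤ a + 4) (hg : g < 2) (hK : K = (2 - g) * b - d * a) (hKn : K * n = 4 * b) :
    n * a = 2 * b ∨ n * a = 4 * b ∨ n = 28 ∧ a = 3 ∧ b = 7 := by
  have hb8 : b ≤ 8 := by omega
  have hb1 : 1 ≤ b := by omega
  have hK3 : K ≤ 3 := by
    by_contra! hK4
    have h1 := mul_nonneg (show 0 ≤ K - 4 by omega) (show 0 ≤ n - 9 by omega)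
    nlinarith
  have hK1 : 1 ≤ K := by
    by_contra! hK0
    have h1 := mul_nonneg (show 0 ≤ -K by omega) (show 0 ≤ n by omega)
    nlinarith
  have ha4 : a ≤ 4 := by omega
  interval_cases K <;> interval_cases g <;> interval_cases a <;> interval_cases b <;> omega

/-- The possible values of `t` when a balanced system of vertices of a tiling with right triangles
with acute angles `t π / 2` and `(1 - t) π / 2` contains a vertex of a regular `n`-gon. -/
theorem vertex_arithmetic {X : Type*} {n : ℕ} (hn : 9 ≤ n) (hn' : n ∉ ({12, 14, 20, 32, 44} : Set ℕ))
    {t : ℝ} (ht0 : 0 < t) (ht1 : t ≤ 1 / 2) (p q r : X → ℕ)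
    (hX : ∀ x, p x * t + q x * (1 - t) + r x = 2 - 4 / n ∨
      ∃ N : ℕ, N ≤ 2 ∧ p x * t + q x * (1 - t) + r x = 2 * N)
    (hpq : (∃ x, q x < p x) → ∃ x, p x < q x) (hqp : (∃ x, p x < q x) → ∃ x, q x < p x)
    {x₀ : X} (hx₀ : p x₀ * t + q x₀ * (1 - t) + r x₀ = 2 - 4 / n) :
    t = 2 / n ∨ t = 4 / n ∨ (n = 28 ∧ t = 3 / 7) := by
  have hnr : (9 : ℝ) ≤ n := by exact_mod_cast hn
  have hn0 : (0 : ℝ) < n := by linarith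
  simp only [Set.mem_insert_iff, Set.mem_singleton_iff, not_or] at hn'
  obtain ⟨u, hu⟩ : ∃ u : ℝ, u = 4 / n := ⟨_, rfl⟩
  have hu0 : 0 < u := by rw [hu]; positivity
  have hu1 : u < 1 / 2 := by rw [hu, div_lt_iff₀ hn0]; linarith
  have hun : u * n = 4 := by rw [hu]; field_simp
  -- If a point with the vertex angle of the polygon has an excess b of large angles, then bt + 2 =
  -- p + r + b + 4/n. Together with t ≤ 1/2 this leaves few pairs (b, p + r).
  by_cases hA : ∃ x, p x < q x ∧ p x * t + q x * (1 - t) + r x = 2 - 4 / n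
  · obtain ⟨x, hlt, hx⟩ := hA
    obtain ⟨b, hb⟩ : ∃ b, q x = p x + b := ⟨q x - p x, by omega⟩
    have hb1 : 1 ≤ b := by omega
    have hbr : (1 : ℝ) ≤ b := by exact_mod_cast hb1
    rw [hb, ← hu] at hx
    push_cast at hx
    have e : b * t + 2 = p x + r x + b + u := by linarith
    have hlow : (p x + r x : ℝ) + b / 2 < 2 := by nlinarith
    have hlow' : 2 * (p x + r x) + b < 4 := by
      have : (2 * (p x + r x) + b : ℝ) < 4 := by linarith
      exact_mod_cast this
    have h3 : (b : ℝ) * t ≤ b / 2 := by nlinarith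
    have hcase : (b = 1 ∧ p x + r x = 0) ∨ (b = 1 ∧ p x + r x = 1) ∨ (b = 2 ∧ p x + r x = 0) ∨
        (b = 3 ∧ p x + r x = 0) := by omega
    rcases hcase with ⟨h1, h2⟩ | ⟨h1, h2⟩ | ⟨h1, h2⟩ | ⟨h1, h2⟩
    · have h2' : (p x + r x : ℝ) = 0 := by exact_mod_cast h2
      rw [h1, h2'] at e; push_cast at e
      linarith
    · have h2' : (p x + r x : ℝ) = 1 := by exact_mod_cast h2
      rw [h1, h2'] at e; push_cast at e
      right; left
      rw [← hu]; linarith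
    · have h2' : (p x + r x : ℝ) = 0 := by exact_mod_cast h2
      rw [h1, h2'] at e; push_cast at e
      left
      have : (2 : ℝ) / n = (4 / n) / 2 := by ring
      rw [this, ← hu]; linarith
    · exfalso
      have h2' : (p x + r x : ℝ) = 0 := by exact_mod_cast h2
      rw [h1, h2'] at e; push_cast at e
      have ht : t = (1 + u) / 3 := by linarith
      -- The candidate t = (1 + 4/n)/3 is refuted at a point with an excess d of small angles: for
      -- either value of the angle sum there, the integer equation is solvable only for excluded n.
      obtain ⟨y, hy⟩ := hqp ⟨x, hlt⟩
      obtain ⟨d, hd⟩ : ∃ d, p y = q y + d := ⟨p y - q y, by omega⟩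
      have hd1 : 1 ≤ d := by omega
      rcases hX y with h | ⟨N, hN, h⟩
      · rw [hd, ← hu, ht] at h
        push_cast at h
        have h4 : (d * (n + 4) + 12 + 3 * (q y + r y) * n : ℝ) = 6 * n := by
          linear_combination 3 * n * h - (d + 3) * hun
        have h5 : d * (n + 4) + 12 + 3 * (q y + r y) * n = 6 * n := by exact_mod_cast h4
        generalize q y + r y = g at h5
        have hg : g ≤ 1 := by
          by_contra! hg
          nlinarith
        have hd6 : d ≤ 5 := by
          by_contra! hd6
          nlinarith
        interval_cases g <;> interval_cases d <;> omega
      · rw [hd, ht] at h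
        push_cast at h
        have h4 : (d * (n + 4) + 3 * (q y + r y) * n : ℝ) = 6 * N * n := by
          linear_combination 3 * n * h - d * hun
        have h5 : d * (n + 4) + 3 * (q y + r y) * n = 6 * N * n := by exact_mod_cast h4
        generalize q y + r y = g at h5
        have h6 : (6 * (N : ℤ) - 3 * g - d) * (n + 4) = 12 * (2 * N - g) := by
          have : (d * (n + 4) + 3 * g * n : ℤ) = 6 * N * n := by exact_mod_cast h5
          linear_combination (-1) * this
        obtain ⟨f, hf⟩ : ∃ f : ℤ, f = 6 * (N : ℤ) - 3 * g - d := ⟨_, rfl⟩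
        obtain ⟨w, hw⟩ : ∃ w : ℤ, w = 2 * (N : ℤ) - g := ⟨_, rfl⟩
        rw [← hf, ← hw] at h6
        have hw4 : w ≤ 4 := by omega
        exact not_mul_add_four_eq (by omega) (by omega) (show (1 : ℤ) ≤ d by omega) hw4 (by omega) h6
  -- Now large angles never prevail at a point with the vertex angle. At x₀ equality p = q would
  -- make 4/n an integer, so small angles prevail there. By balance large ones prevail at some y,
  -- whose angle sum must then be 2N.
  · push Not at hA
    have hne : p x₀ ≠ q x₀ := by
      intro heq
      rw [heq, ← hu] at hx₀
      have h1 : (q x₀ + r x₀ : ℝ) + u = 2 := by linarith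
      have h2 : (1 : ℝ) < q x₀ + r x₀ := by linarith
      have h3 : (q x₀ + r x₀ : ℝ) < 2 := by linarith
      have h2' : 1 < q x₀ + r x₀ := by exact_mod_cast h2
      have h3' : q x₀ + r x₀ < 2 := by exact_mod_cast h3
      omega
    have hlt : q x₀ < p x₀ := by
      rcases lt_or_gt_of_ne hne with h | h
      · exact absurd hx₀ (hA x₀ h)
      · exact h
    obtain ⟨y, hy⟩ := hpq ⟨x₀, hlt⟩
    obtain ⟨N, hN, h⟩ := (hX y).resolve_left (hA y hy)
    obtain ⟨d, hd⟩ : ∃ d, p x₀ = q x₀ + d := ⟨p x₀ - q x₀, by omega⟩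
    obtain ⟨b, hb⟩ : ∃ b, q y = p y + b := ⟨q y - p y, by omega⟩
    have hd1 : 1 ≤ d := by omega
    have hb1 : 1 ≤ b := by omega
    have hbr : (1 : ℝ) ≤ b := by exact_mod_cast hb1
    rw [hb] at h
    push_cast at h
    -- The equation at y reads bt = a. Thus t = a/b is rational, and N ≤ 2 gives b ≤ a + 4.
    obtain ⟨a, ha⟩ : ∃ a : ℤ, a = b + p y + r y - 2 * N := ⟨_, rfl⟩
    have har : (b : ℝ) * t = a := by
      rw [ha]; push_cast; linarith
    have ha1 : 1 ≤ a := by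
      have : (0 : ℝ) < a := by rw [← har]; positivity
      have : 0 < a := by exact_mod_cast this
      omega
    have ha2 : 2 * a ≤ b := by
      have : (2 * a : ℝ) ≤ b := by rw [← har]; nlinarith
      exact_mod_cast this
    have hab : (b : ℤ) ≤ a + 4 := by omega
    rw [hd, ← hu] at hx₀
    push_cast at hx₀
    -- K is b · 4/n, obtained by putting t = a/b into the equation at x₀ and clearing denominators.
    obtain ⟨K, hK⟩ : ∃ K : ℤ, K = (2 - (q x₀ + r x₀)) * b - d * a := ⟨_, rfl⟩
    have hKn : K * n = 4 * b := by
      have : (K * n : ℝ) = 4 * b := by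
        rw [hK]; push_cast
        linear_combination (-n * b : ℝ) * hx₀ + (d * n : ℝ) * har + b * hun
      exact_mod_cast this
    have hg : (q x₀ + r x₀ : ℝ) < 2 := by nlinarith [mul_nonneg (Nat.cast_nonneg (α := ℝ) d) ht0.le]
    have hg' : q x₀ + r x₀ < 2 := by exact_mod_cast hg
    have key : (n : ℤ) * a = 2 * b ∨ (n : ℤ) * a = 4 * b ∨ n = 28 ∧ a = 3 ∧ b = 7 := by
      have := small_fraction_arithmetic (by omega) (by omega) ha1 ha2 hab hg'
        (by push_cast; exact hK) hKn
      omega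
    have ht : t = a / b := by field_simp; linarith
    rcases key with h | h | ⟨h1, h2, h3⟩
    · left
      have : (n * a : ℝ) = 2 * b := by exact_mod_cast h
      rw [ht, div_eq_div_iff (by positivity) (by positivity)]; linarith
    · right; left
      have : (n * a : ℝ) = 4 * b := by exact_mod_cast h
      rw [ht, div_eq_div_iff (by positivity) (by positivity)]; linarith
    · right; right
      refine ⟨h1, ?_⟩
      rw [ht, h2, h3]; norm_num

/-! ### Right triangles with labelled vertices and their counts at a point -/

theorem triangleAngle_pos (t : Affine.Triangle ℝ ℂ) (i : Fin 3) : 0 < triangleAngle t i := by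
  refine lt_of_le_of_ne (angle_nonneg _ _ _) (Ne.symm ?_)
  apply angle_ne_zero_of_not_collinear
  have h := affineIndependent_iff_not_collinear.1 t.independent
  have : ({t.points (i + 1), t.points i, t.points (i + 2)} : Set ℂ) = Set.range t.points := by
    ext z
    simp only [Set.mem_insert_iff, Set.mem_singleton_iff, Set.mem_range]
    constructor
    · rintro (h | h | h)
      · exact ⟨_, h.symm⟩
      · exact ⟨_, h.symm⟩
      · exact ⟨_, h.symm⟩
    · rintro ⟨k, rfl⟩
      rcases fin_three_cases i k with rfl | rfl | rfl <;> simp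
  rwa [this]

theorem sum_triangleAngle (t : Affine.Triangle ℝ ℂ) :
    triangleAngle t 0 + triangleAngle t 1 + triangleAngle t 2 = π := by
  have h := angle_add_angle_add_angle_eq_pi (p₁ := t.points 0) (p₂ := t.points 1) (t.points 2)
    (fun h => absurd (t.independent.injective h) (by decide))
  change ∠ (t.points 1) (t.points 0) (t.points 2) + ∠ (t.points 2) (t.points 1) (t.points 0) +
    ∠ (t.points 0) (t.points 2) (t.points 1) = π
  linarith [angle_comm (t.points 1) (t.points 0) (t.points 2),
    angle_comm (t.points 2) (t.points 1) (t.points 0),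
    angle_comm (t.points 0) (t.points 2) (t.points 1)]

theorem smallestAngle_eq (t : Affine.Triangle ℝ ℂ) (i : Fin 3) : smallestAngle t =
    min (triangleAngle t i) (min (triangleAngle t (i + 1)) (triangleAngle t (i + 2))) := by
  fin_cases i
  · rfl
  · change _ = min (triangleAngle t 1) (min (triangleAngle t 2) (triangleAngle t 0))
    rw [smallestAngle]
    ac_rfl
  · change _ = min (triangleAngle t 2) (min (triangleAngle t 0) (triangleAngle t 1))
    rw [smallestAngle]
    ac_rfl

/-- A labelling of the vertices of a right triangle: the vertices `σ 0`, `σ 1`, `σ 2` carry the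
angles `α`, `π / 2 - α` and `π / 2`. -/
structure IsLabelling (t : Affine.Triangle ℝ ℂ) (α : ℝ) (σ : Equiv.Perm (Fin 3)) : Prop where
  small : triangleAngle t (σ 0) = α
  large : triangleAngle t (σ 1) = π / 2 - α
  right : triangleAngle t (σ 2) = π / 2

theorem exists_labelling {t : Affine.Triangle ℝ ℂ} (h : IsRightTriangle t) :
    0 < smallestAngle t ∧ smallestAngle t ≤ π / 4 ∧ ∃ σ, IsLabelling t (smallestAngle t) σ := by
  obtain ⟨i, hi⟩ := h
  have hsum := sum_triangleAngle t
  rw [← fin_three_sum_cyclic (triangleAngle t) i] at hsum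
  have h1 := triangleAngle_pos t (i + 1)
  have h2 := triangleAngle_pos t (i + 2)
  rw [smallestAngle_eq t i, hi, min_eq_right (by
    apply (min_le_left _ _).trans; linarith)]
  refine ⟨lt_min h1 h2, ?_, ?_⟩
  · rcases le_total (triangleAngle t (i + 1)) (triangleAngle t (i + 2)) with h | h
    · rw [min_eq_left h]; linarith
    · rw [min_eq_right h]; linarith
  · have hp : ∀ i : Fin 3, (∃ σ : Equiv.Perm (Fin 3), σ 0 = i + 1 ∧ σ 1 = i + 2 ∧ σ 2 = i) ∧
        (∃ σ : Equiv.Perm (Fin 3), σ 0 = i + 2 ∧ σ 1 = i + 1 ∧ σ 2 = i) := by decide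
    rcases le_total (triangleAngle t (i + 1)) (triangleAngle t (i + 2)) with h | h
    · obtain ⟨σ, e0, e1, e2⟩ := (hp i).1
      refine ⟨σ, ?_, ?_, ?_⟩
      · rw [e0, min_eq_left h]
      · rw [e1, min_eq_left h]; linarith
      · rw [e2, hi]
    · obtain ⟨σ, e0, e1, e2⟩ := (hp i).2
      refine ⟨σ, ?_, ?_, ?_⟩
      · rw [e0, min_eq_right h]
      · rw [e1, min_eq_right h]; linarith
      · rw [e2, hi]

theorem triangleAngle_perm (t : Affine.Triangle ℝ ℂ) (σ : Equiv.Perm (Fin 3)) (i : Fin 3) :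
    ∠ (t.points (σ (i + 1))) (t.points (σ i)) (t.points (σ (i + 2))) = triangleAngle t (σ i) := by
  have h : ∀ (σ : Equiv.Perm (Fin 3)) (i : Fin 3), (σ (i + 1) = σ i + 1 ∧ σ (i + 2) = σ i + 2) ∨
      (σ (i + 1) = σ i + 2 ∧ σ (i + 2) = σ i + 1) := by decide
  rw [triangleAngle]
  rcases h σ i with ⟨h1, h2⟩ | ⟨h1, h2⟩
  · rw [h1, h2]
  · rw [h1, h2, angle_comm]

theorem smallestAngle_of_similar {s t : Affine.Triangle ℝ ℂ} (h : SimilarTriangles s t) :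
    smallestAngle s = smallestAngle t := by
  obtain ⟨σ, hσ⟩ := h
  have hang : ∀ i, triangleAngle s i = triangleAngle t (σ i) := by
    intro i
    have h1 := hσ.index_map ![i + 1, i, i + 2]
    have e1 : s.points ∘ ![i + 1, i, i + 2] = ![s.points (i + 1), s.points i, s.points (i + 2)] := by
      ext k; fin_cases k <;> rfl
    have e2 : (t.points ∘ σ) ∘ ![i + 1, i, i + 2] =
        ![t.points (σ (i + 1)), t.points (σ i), t.points (σ (i + 2))] := by
      ext k; fin_cases k <;> rfl
    rw [e1, e2] at h1
    rw [← triangleAngle_perm, triangleAngle]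
    exact h1.angle_eq
  have hp : ∀ σ : Equiv.Perm (Fin 3), (σ 1 = σ 0 + 1 ∧ σ 2 = σ 0 + 2) ∨
      (σ 1 = σ 0 + 2 ∧ σ 2 = σ 0 + 1) := by decide
  rw [smallestAngle_eq t (σ 0), smallestAngle, hang, hang, hang]
  rcases hp σ with ⟨h1, h2⟩ | ⟨h1, h2⟩
  · rw [h1, h2]
  · rw [h1, h2, min_comm (triangleAngle t (σ 0 + 2))]

open Classical in
/-- Number of triangles whose vertex labelled `k` is at `x`. -/
noncomputable def vertexCount {m : ℕ} (T : Fin m → Affine.Triangle ℝ ℂ)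
    (σ : Fin m → Equiv.Perm (Fin 3)) (k : Fin 3) (x : ℂ) : ℕ :=
  (Finset.univ.filter fun i => (T i).points (σ i k) = x).card

/-- Each label occurs once in every triangle, so its counts over all points sum to m. A deficit at
one point is made up at another. -/
theorem exists_lt_vertexCount {m : ℕ} {T : Fin m → Affine.Triangle ℝ ℂ}
    {σ : Fin m → Equiv.Perm (Fin 3)} {k l : Fin 3}
    (h : ∃ x, vertexCount T σ k x < vertexCount T σ l x) :
    ∃ x, vertexCount T σ l x < vertexCount T σ k x := by
  classical
  obtain ⟨x, hx⟩ := h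
  by_contra! hle
  let V : Finset ℂ := insert x (Finset.univ.image fun i => (T i).points (σ i k)) ∪
    Finset.univ.image fun i => (T i).points (σ i l)
  have hk : ∀ j, (∀ i, (T i).points (σ i j) ∈ V) → ∑ y ∈ V, vertexCount T σ j y = m := by
    intro j hj
    have := Finset.card_eq_sum_card_fiberwise (s := Finset.univ) (t := V)
      (f := fun i => (T i).points (σ i j)) (fun i _ => hj i)
    rw [Finset.card_fin] at this
    exact this.symm
  have h1 := hk k fun i => by simp [V]
  have h2 := hk l fun i => by simp [V]
  have := Finset.sum_lt_sum (s := V) (f := vertexCount T σ k) (g := vertexCount T σ l)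
    (fun y _ => hle y) ⟨x, by simp [V], hx⟩
  omega

open Classical in
theorem localAngle_labelling {t : Affine.Triangle ℝ ℂ} {α : ℝ} {σ : Equiv.Perm (Fin 3)}
    (h : IsLabelling t α σ) (x : ℂ) : ∃ M : ℕ, localAngle t x =
      (if t.points (σ 0) = x then 1 else 0 : ℕ) * α + (if t.points (σ 1) = x then 1 else 0 : ℕ) *
        (π / 2 - α) + (if t.points (σ 2) = x then 1 else 0 : ℕ) * (π / 2) + M * π := by
  have hinj : ∀ i j, i ≠ j → t.points (σ i) = x → t.points (σ j) ≠ x := fun i j hij h1 h2 =>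
    hij (σ.injective (t.independent.injective (h1.trans h2.symm)))
  by_cases h0 : t.points (σ 0) = x
  · refine ⟨0, ?_⟩
    rw [if_pos h0, if_neg (hinj 0 1 (by decide) h0), if_neg (hinj 0 2 (by decide) h0), ← h0,
      localAngle_vertex, h.small]
    simp
  by_cases h1 : t.points (σ 1) = x
  · refine ⟨0, ?_⟩
    rw [if_neg h0, if_pos h1, if_neg (hinj 1 2 (by decide) h1), ← h1, localAngle_vertex, h.large]
    simp
  by_cases h2 : t.points (σ 2) = x
  · refine ⟨0, ?_⟩
    rw [if_neg h0, if_neg h1, if_pos h2, ← h2, localAngle_vertex, h.right]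
    simp
  rw [if_neg h0, if_neg h1, if_neg h2]
  rcases localAngle_of_ne_vertex t x (by
    intro i hi
    obtain ⟨j, rfl⟩ := σ.surjective i
    fin_cases j
    · exact h0 hi.symm
    · exact h1 hi.symm
    · exact h2 hi.symm) with h | h | h
  · exact ⟨0, by simp [h]⟩
  · exact ⟨1, by simp [h]⟩
  · exact ⟨2, by simp [h]⟩

theorem sum_localAngle_labelling {m : ℕ} {T : Fin m → Affine.Triangle ℝ ℂ} {α : ℝ}
    {σ : Fin m → Equiv.Perm (Fin 3)} (h : ∀ i, IsLabelling (T i) α (σ i)) (x : ℂ) :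
    ∃ M : ℕ, ∑ i, localAngle (T i) x = vertexCount T σ 0 x * α +
      vertexCount T σ 1 x * (π / 2 - α) + vertexCount T σ 2 x * (π / 2) + M * π := by
  classical
  choose M hM using fun i => localAngle_labelling (h i) x
  refine ⟨∑ i, M i, ?_⟩
  simp only [hM, Finset.sum_add_distrib, ← Finset.sum_mul]
  have hc : ∀ k, (∑ i, ((if (T i).points (σ i k) = x then 1 else 0 : ℕ) : ℝ)) =
      vertexCount T σ k x := by
    intro k
    rw [vertexCount, Finset.card_filter]
    push_cast
    rfl
  rw [hc, hc, hc]
  push_cast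
  rfl

theorem regularPolygon_eq (n : ℕ) (c r : ℂ) :
    (Set.range fun k : Fin n => c + r * Complex.exp (2 * π * Complex.I * (k : ℕ) / n)) =
      Set.range fun k : Fin n => polyVertex c r n (k : ℕ) := by
  congr 1
  ext k
  rw [polyVertex, unitPt]
  congr 3
  push_cast
  ring

/-- Angle sums are taken from the fan and divided by π/2. Straight and full angles of tiles
contribute Mπ: at a polygon vertex the sum is below π, so M = 0, and elsewhere M is subtracted from
N. -/
theorem smallestAngle_cases {n : ℕ} (hn : 9 ≤ n) (hn' : n ∉ ({12, 14, 20, 32, 44} : Set ℕ))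
    {c r : ℂ} (hr : r ≠ 0) {m : ℕ} {T : Fin m → Affine.Triangle ℝ ℂ}
    (hT : IsTiling T (convexHull ℝ (Set.range fun k : Fin n => polyVertex c r n (k : ℕ))))
    {α : ℝ} (hα0 : 0 < α) (hα1 : α ≤ π / 4) {σ : Fin m → Equiv.Perm (Fin 3)}
    (h : ∀ i, IsLabelling (T i) α (σ i)) :
    α = π / n ∨ α = 2 * π / n ∨ (n = 28 ∧ α = 3 * π / 14) := by
  have hn3 : 3 ≤ n := by omega
  have hpi := pi_pos
  have hfan : ∀ x, ∑ i, localAngle (T i) x = ∑ k, localAngle (fanTriangle hn3 c hr k) x := by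
    intro x
    rw [sum_localAngle_eq_integral hT.1 hT.2 x,
      sum_localAngle_eq_integral (fan_iUnion hn3 c hr) (fan_disjoint hn3 c hr) x]
  obtain ⟨t, ht⟩ : ∃ t, t = α * 2 / π := ⟨_, rfl⟩
  have hαt : α = t * (π / 2) := by rw [ht]; field_simp
  have ht0 : 0 < t := by rw [ht]; positivity
  have ht1 : t ≤ 1 / 2 := by rw [ht, div_le_iff₀ hpi]; linarith
  have hvert : ∀ j : ℤ, vertexCount T σ 0 (polyVertex c r n j) * t +
      vertexCount T σ 1 (polyVertex c r n j) * (1 - t) +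
      vertexCount T σ 2 (polyVertex c r n j) = 2 - 4 / (n : ℝ) := by
    intro j
    obtain ⟨M, hM⟩ := sum_localAngle_labelling h (polyVertex c r n j)
    rw [hfan, sum_localAngle_fan_vertex, hαt] at hM
    have hM2 : (vertexCount T σ 0 (polyVertex c r n j) * t +
      vertexCount T σ 1 (polyVertex c r n j) * (1 - t) +
      vertexCount T σ 2 (polyVertex c r n j) + 2 * M) * (π / 2) = (2 - 4 / (n : ℝ)) * (π / 2) := by
      linear_combination -hM
    have hM3 := mul_right_cancel₀ (by positivity) hM2
    have hpos : (0 : ℝ) < 4 / n := by positivity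
    have h1t : 0 ≤ 1 - t := by linarith
    have hnn : 0 ≤ vertexCount T σ 0 (polyVertex c r n j) * t +
      vertexCount T σ 1 (polyVertex c r n j) * (1 - t) +
      vertexCount T σ 2 (polyVertex c r n j) := by positivity
    have hM4 : (M : ℝ) < 1 := by linarith
    have hM5 : M = 0 := by
      have : M < 1 := by exact_mod_cast hM4
      omega
    rw [hM5] at hM3
    simpa using hM3
  have hother : ∀ x, (∀ j : ℤ, x ≠ polyVertex c r n j) → ∃ N : ℕ, N ≤ 2 ∧ vertexCount T σ 0 x * t +
      vertexCount T σ 1 x * (1 - t) + vertexCount T σ 2 x = 2 * (N : ℝ) := by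
    intro x hx
    obtain ⟨M, hM⟩ := sum_localAngle_labelling h x
    obtain ⟨N, hN, hN2⟩ := sum_localAngle_fan_other hn3 c hr x hx
    rw [hfan, hN2, hαt] at hM
    have hM2 : (vertexCount T σ 0 x * t + vertexCount T σ 1 x * (1 - t) +
      vertexCount T σ 2 x + 2 * M) * (π / 2) = (2 * N) * (π / 2) := by
      linear_combination -hM
    have hM3 := mul_right_cancel₀ (by positivity) hM2
    have h1t : 0 ≤ 1 - t := by linarith
    have hnn : 0 ≤ vertexCount T σ 0 x * t + vertexCount T σ 1 x * (1 - t) +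
      vertexCount T σ 2 x := by positivity
    have hMN : M ≤ N := by
      have : (M : ℝ) ≤ N := by linarith
      exact_mod_cast this
    refine ⟨N - M, by omega, ?_⟩
    rw [Nat.cast_sub hMN]
    linarith
  have := vertex_arithmetic hn hn' ht0 ht1 (vertexCount T σ 0) (vertexCount T σ 1)
    (vertexCount T σ 2) (fun x => by
      by_cases hx : ∃ j : ℤ, x = polyVertex c r n j
      · obtain ⟨j, rfl⟩ := hx
        exact Or.inl (hvert j)
      · push Not at hx
        exact Or.inr (hother x hx)) exists_lt_vertexCount exists_lt_vertexCount (hvert 0)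
  rw [hαt]
  rcases this with h | h | ⟨h1, h2⟩
  · left; rw [h]; ring
  · right; left; rw [h]; ring
  · right; right; exact ⟨h1, by rw [h2]; ring⟩

/-! ### Galois twists of the plane -/

open IntermediateField in
/-- For a primitive root of unity `ζ` and `k` prime to its order, the automorphism `ζ ↦ ζ ^ k` of
the cyclotomic field extends to a semilinear additive self-map of the plane that commutes with
complex conjugation. -/
theorem exists_semilinear {ζ : ℂ} {N k : ℕ} (hN : 0 < N) (hζ : IsPrimitiveRoot ζ N)
    (hk : k.Coprime N) :
    ∃ F : ℂ →+ ℂ, (∀ z, F (ζ * z) = ζ ^ k * F z) ∧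
      (∀ z, F ((starRingEnd ℂ) z) = (starRingEnd ℂ) (F z)) ∧ F 1 = 1 := by
  have hint : IsIntegral ℚ ζ := (hζ.isIntegral hN).tower_top
  -- Both ζ and ζ^k have the cyclotomic polynomial as minimal polynomial.
  have hroot : ζ ^ k ∈ (minpoly ℚ ζ).aroots ℂ := by
    rw [Polynomial.mem_aroots]
    refine ⟨minpoly.ne_zero hint, ?_⟩
    rw [← Polynomial.cyclotomic_eq_minpoly_rat hζ hN,
      Polynomial.cyclotomic_eq_minpoly_rat (hζ.pow_of_coprime k hk) hN]
    exact minpoly.aeval _ _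
  let φ : ℚ⟮ζ⟯ →ₐ[ℚ] ℂ := (algHomAdjoinIntegralEquiv ℚ hint).symm ⟨ζ ^ k, hroot⟩
  have hφ : φ (AdjoinSimple.gen ℚ ζ) = ζ ^ k :=
    algHomAdjoinIntegralEquiv_symm_apply_gen ℚ hint ⟨ζ ^ k, hroot⟩
  -- A ℚ(ζ)-linear projection of ℂ onto ℚ(ζ); following it by the field embedding gives a semilinear
  -- map on all of ℂ.
  obtain ⟨p, hp⟩ := (Algebra.linearMap ℚ⟮ζ⟯ ℂ).exists_leftInverse_of_injective
    (LinearMap.ker_eq_bot.2 (algebraMap ℚ⟮ζ⟯ ℂ).injective)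
  have hp1 : p 1 = 1 := by
    have := LinearMap.congr_fun hp 1
    simpa using this
  have hpz : ∀ z, p (ζ * z) = AdjoinSimple.gen ℚ ζ * p z := by
    intro z
    have : ζ * z = AdjoinSimple.gen ℚ ζ • z := by
      rw [Algebra.smul_def, AdjoinSimple.algebraMap_gen]
    rw [this, map_smul, smul_eq_mul]
  let F₀ : ℂ →+ ℂ := φ.toRingHom.toAddMonoidHom.comp p.toAddMonoidHom
  have hF₀ : ∀ z, F₀ (ζ * z) = ζ ^ k * F₀ z := by
    intro z
    change φ (p (ζ * z)) = ζ ^ k * φ (p z)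
    rw [hpz, map_mul, hφ]
  have hF₁ : F₀ 1 = 1 := by
    change φ (p 1) = 1
    rw [hp1, map_one]
  have hζ0 : ζ ≠ 0 := hζ.ne_zero hN.ne'
  have hnorm : ‖ζ‖ = 1 := hζ.norm'_eq_one hN.ne'
  have hcζ : (starRingEnd ℂ) ζ = ζ⁻¹ := (Complex.inv_eq_conj hnorm).symm
  have hinv : ∀ z, F₀ (ζ⁻¹ * z) = (ζ⁻¹) ^ k * F₀ z := by
    intro z
    have := hF₀ (ζ⁻¹ * z)
    rw [mul_inv_cancel_left₀ hζ0] at this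
    rw [this, inv_pow, inv_mul_cancel_left₀ (pow_ne_zero _ hζ0)]
  let conjHom : ℂ →+ ℂ := (starRingEnd ℂ).toAddMonoidHom
  -- Averaging with the conjugate by complex conjugation enforces commutation. Semilinearity
  -- survives because conjugation inverts ζ.
  refine ⟨(AddMonoidHom.mulLeft (2⁻¹ : ℂ)).comp (F₀ + conjHom.comp (F₀.comp conjHom)), ?_, ?_, ?_⟩
  · intro z
    change 2⁻¹ * (F₀ (ζ * z) + (starRingEnd ℂ) (F₀ ((starRingEnd ℂ) (ζ * z)))) =
      ζ ^ k * (2⁻¹ * (F₀ z + (starRingEnd ℂ) (F₀ ((starRingEnd ℂ) z))))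
    rw [hF₀, map_mul, hcζ, hinv, map_mul, map_pow, map_inv₀, hcζ, inv_inv]
    ring
  · intro z
    change 2⁻¹ * (F₀ ((starRingEnd ℂ) z) +
      (starRingEnd ℂ) (F₀ ((starRingEnd ℂ) ((starRingEnd ℂ) z)))) =
      (starRingEnd ℂ) (2⁻¹ * (F₀ z + (starRingEnd ℂ) (F₀ ((starRingEnd ℂ) z))))
    rw [map_mul, map_add, Complex.conj_conj, Complex.conj_conj, map_inv₀, map_ofNat, add_comm]
  · change 2⁻¹ * (F₀ 1 + (starRingEnd ℂ) (F₀ ((starRingEnd ℂ) 1))) = 1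
    rw [map_one (starRingEnd ℂ), hF₁, map_one (starRingEnd ℂ)]
    norm_num

theorem isPrimitiveRoot_unitPt {n : ℕ} (hn : n ≠ 0) : IsPrimitiveRoot (unitPt n 1) (2 * n) := by
  have h := Complex.isPrimitiveRoot_exp (2 * n) (by omega)
  convert h using 1
  rw [unitPt]
  congr 1
  have : (n : ℂ) ≠ 0 := by exact_mod_cast hn
  push_cast
  field_simp

theorem unitPt_natCast (n k : ℕ) : unitPt n k = unitPt n 1 ^ k := by
  rw [unitPt, unitPt, ← Complex.exp_nat_mul]
  congr 1
  push_cast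
  ring

/-- An additive self-map `F` of the plane that is semilinear with respect to the automorphism
`ζ ↦ ζ ^ k` of the field of `2 n`-th roots of unity and commutes with conjugation. -/
structure IsTwist (n : ℕ) (k : ℤ) (F : ℂ →+ ℂ) : Prop where
  unitPt_mul : ∀ (d : ℤ) (z : ℂ), F (unitPt n d * z) = unitPt n (k * d) * F z
  conj : ∀ z, F ((starRingEnd ℂ) z) = (starRingEnd ℂ) (F z)
  one : F 1 = 1

theorem exists_isTwist {n k : ℕ} (hn : n ≠ 0) (hk : k.Coprime (2 * n)) :
    ∃ F : ℂ →+ ℂ, IsTwist n k F := by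
  obtain ⟨F, h1, h2, h3⟩ := exists_semilinear (by omega) (isPrimitiveRoot_unitPt hn) hk
  refine ⟨F, fun d => ?_, h2, h3⟩
  induction d with
  | zero => intro z; simp [unitPt_zero]
  | succ i ih =>
    intro z
    have e : unitPt n (k * ((i : ℤ) + 1)) = unitPt n (k * i) * unitPt n 1 ^ k := by
      rw [mul_add, mul_one, unitPt_add, unitPt_natCast n k]
    rw [unitPt_add, mul_assoc, ih, h1, e]
    ring
  | pred i ih =>
    intro z
    have e : unitPt n (k * (-(i : ℤ))) = unitPt n (k * (-(i : ℤ) - 1)) * unitPt n 1 ^ k := by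
      rw [← unitPt_natCast n k, ← unitPt_add]; congr 1; ring
    have e2 : unitPt n (-(i : ℤ)) * z = unitPt n 1 * (unitPt n (-(i : ℤ) - 1) * z) := by
      rw [← mul_assoc, ← unitPt_add]; congr 2; ring
    have h := ih z
    rw [e2, h1, e] at h
    have h0 : unitPt n 1 ^ k ≠ 0 := pow_ne_zero _ (unitPt_ne_zero _ _)
    apply mul_left_cancel₀ h0
    rw [h]
    ring

namespace IsTwist

variable {n : ℕ} {k : ℤ} {F : ℂ →+ ℂ}

theorem map_ofReal (h : IsTwist n k F) (x : ℝ) : F x = ((F x).re : ℂ) := by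
  have := h.conj x
  rw [Complex.conj_ofReal] at this
  exact (Complex.conj_eq_iff_re.1 this.symm).symm

/-- Reals go to reals, being fixed by conjugation, so F carries the line of direction d into the
line of direction kd. Collinearity along these directions is all that additivity of the twisted area
needs. -/
theorem ofReal_mul_unitPt (h : IsTwist n k F) (x : ℝ) (d : ℤ) :
    F (x * unitPt n d) = ((F x).re : ℂ) * unitPt n (k * d) := by
  rw [mul_comm, h.unitPt_mul, h.map_ofReal, mul_comm]
  simp

theorem map_unitPt (h : IsTwist n k F) (d : ℤ) : F (unitPt n d) = unitPt n (k * d) := by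
  have := h.unitPt_mul d 1
  rwa [mul_one, h.one, mul_one] at this

end IsTwist

theorem unitPt_sub_unitPt_neg (n : ℕ) (d : ℤ) :
    unitPt n d - unitPt n (-d) = 2 * sin (d * π / n) * Complex.I := by
  rw [← conj_unitPt, Complex.sub_conj, unitPt_im]
  push_cast
  ring

/-! ### Signed side ends and additivity of the twisted area -/

/-- The cross product of two plane vectors. -/
noncomputable def cross (z w : ℂ) : ℝ := ((starRingEnd ℂ) z * w).im

theorem cross_eq (z w : ℂ) : cross z w = z.re * w.im - z.im * w.re := by
  simp [cross]; ring

/-- Twice the signed area of a triangle. -/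
noncomputable def signedArea (t : Affine.Triangle ℝ ℂ) : ℝ :=
  cross (t.points 1 - t.points 0) (t.points 2 - t.points 0)

theorem signedArea_eq (t : Affine.Triangle ℝ ℂ) (k : Fin 3) :
    signedArea t = cross (t.points (k + 1) - t.points k) (t.points (k + 2) - t.points k) := by
  fin_cases k
  · rfl
  · change _ = cross (t.points 2 - t.points 1) (t.points 0 - t.points 1)
    rw [signedArea, cross_eq, cross_eq]
    simp only [Complex.sub_re, Complex.sub_im]
    ring
  · change _ = cross (t.points 0 - t.points 2) (t.points 1 - t.points 2)
    rw [signedArea, cross_eq, cross_eq]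
    simp only [Complex.sub_re, Complex.sub_im]
    ring

theorem fin_three_add (k : Fin 3) :
    k + 1 + 1 = k + 2 ∧ k + 1 + 2 = k ∧ k + 2 + 1 = k ∧ k + 2 + 2 = k + 1 := by
  revert k; decide

/-- Cramer's rule. -/
theorem bary_linear_mul_signedArea (t : Affine.Triangle ℝ ℂ) (k : Fin 3) (w : ℂ) :
    (bary t k).linear w * signedArea t = cross (t.points (k + 2) - t.points (k + 1)) w := by
  have h := eq_bary_linear_smul t (k + 1) w
  have e1 : k + 1 + 1 = k + 2 := (fin_three_add k).1
  have e2 : k + 1 + 2 = k := (fin_three_add k).2.1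
  rw [e1, e2] at h
  rw [signedArea_eq t (k + 1), e1, e2]
  conv_rhs => rw [h]
  simp only [cross_eq, Complex.add_re, Complex.add_im, Complex.smul_re, Complex.smul_im, smul_eq_mul]
  ring

/-- The orientation of a triangle. -/
noncomputable def orientation (t : Affine.Triangle ℝ ℂ) : ℝ := if 0 < signedArea t then 1 else -1

/-- Signed number of sides of `t` ending at `x` in the direction `±u`, read off from the germs of
`t` at `x` on both sides of the line through `x` with direction `u`. -/
noncomputable def turn (t : Affine.Triangle ℝ ℂ) (x u : ℂ) : ℝ :=
  germInd t x u (Complex.I * u) - germInd t x u (-(Complex.I * u)) +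
    germInd t x (-u) (-(Complex.I * u)) - germInd t x (-u) (Complex.I * u)

/-- The quantity `turn` combines four germ indicators, and the sum of each over a tiling depends
only on the union. -/
theorem sum_turn_eq {ι κ : Type*} [Fintype ι] [Fintype κ] {T : ι → Affine.Triangle ℝ ℂ}
    {S : κ → Affine.Triangle ℝ ℂ}
    (hU : (⋃ i, triangleRegion (T i)) = ⋃ i, triangleRegion (S i))
    (hT : ∀ i j, i ≠ j → Disjoint (interior (triangleRegion (T i))) (interior (triangleRegion (T j))))
    (hS : ∀ i j, i ≠ j → Disjoint (interior (triangleRegion (S i))) (interior (triangleRegion (S j))))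
    (x : ℂ) {u : ℂ} (hu : u ≠ 0) :
    ∑ i, turn (T i) x u = ∑ i, turn (S i) x u := by
  have key : ∀ w w' : ℂ, (w = u ∨ w = -u) → (w' = Complex.I * u ∨ w' = -(Complex.I * u)) →
      ∑ i, germInd (T i) x w w' = ∑ i, germInd (S i) x w w' := by
    intro w w' hw hw'
    have hnd : ∀ t : Affine.Triangle ℝ ℂ, ∀ k,
        (bary t k).linear w ≠ 0 ∨ (bary t k).linear w' ≠ 0 := by
      intro t k
      have := bary_linear_ne_zero t k hu
      rcases hw with rfl | rfl <;> rcases hw' with rfl | rfl <;> simpa using this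
    rw [sum_germInd hU hT hnd, sum_germInd rfl hS hnd]
  simp only [turn, Finset.sum_add_distrib, Finset.sum_sub_distrib]
  rw [key _ _ (Or.inl rfl) (Or.inl rfl), key _ _ (Or.inl rfl) (Or.inr rfl),
    key _ _ (Or.inr rfl) (Or.inr rfl), key _ _ (Or.inr rfl) (Or.inl rfl)]

theorem lexPos_iff_of_ne {a b c : ℝ} (hb : b ≠ 0) : LexPos a b c ↔ 0 < a ∨ (a = 0 ∧ 0 < b) := by
  simp [LexPos, hb]

theorem lexPos_congr {a b c c' : ℝ} (h : ¬ (a = 0 ∧ b = 0)) : LexPos a b c ↔ LexPos a b c' := by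
  unfold LexPos
  constructor
  · rintro (h1 | ⟨h1, h2 | ⟨h2, -⟩⟩)
    · exact Or.inl h1
    · exact Or.inr ⟨h1, Or.inl h2⟩
    · exact absurd ⟨h1, h2⟩ h
  · rintro (h1 | ⟨h1, h2 | ⟨h2, -⟩⟩)
    · exact Or.inl h1
    · exact Or.inr ⟨h1, Or.inl h2⟩
    · exact absurd ⟨h1, h2⟩ h

theorem germInd_congr {t : Affine.Triangle ℝ ℂ} {x w : ℂ}
    (h : ∀ k, ¬ (bary t k x = 0 ∧ (bary t k).linear w = 0)) (w' w'' : ℂ) :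
    germInd t x w w' = germInd t x w w'' := by
  have : HasGerm t x w w' ↔ HasGerm t x w w'' := forall_congr' fun k => lexPos_congr (h k)
  by_cases hg : HasGerm t x w w'
  · rw [germInd, germInd, if_pos hg, if_pos (this.1 hg)]
  · rw [germInd, germInd, if_neg hg, if_neg fun h' => hg (this.2 h')]

theorem forall_fin_three_cyclic {p : Fin 3 → Prop} (k : Fin 3) :
    (∀ l, p l) ↔ p k ∧ p (k + 1) ∧ p (k + 2) := by
  refine ⟨fun h => ⟨h _, h _, h _⟩, fun ⟨h1, h2, h3⟩ l => ?_⟩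
  rcases fin_three_cases k l with rfl | rfl | rfl <;> assumption

theorem eq_points_of_bary {t : Affine.Triangle ℝ ℂ} {x : ℂ} {k : Fin 3} (h : bary t k x = 1)
    (h1 : bary t (k + 1) x = 0) (h2 : bary t (k + 2) x = 0) : x = t.points k := by
  have hss := sum_bary_smul t x
  rw [← fin_three_sum_cyclic (fun k => bary t k x • t.points k) k] at hss
  simp only [h, h1, h2, zero_smul, add_zero, one_smul] at hss
  exact hss.symm

-- Here a locates x on the line of a side, and b, c are the slopes along and across it. Only germs
-- on the inner side of the line count. Between the ends the two opposite directions cancel, and at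
-- an end just one of them survives.
open Classical in
theorem indicator_alternating {a b c : ℝ} (hb : b ≠ 0) (hc : c ≠ 0) {g : ℝ → ℝ → ℝ}
    (hg : ∀ b' c' : ℝ, b' ≠ 0 → g b' c' =
      if 0 < c' ∧ (0 < a ∨ a = 0 ∧ 0 < b') ∧ (0 < 1 - a ∨ 1 - a = 0 ∧ 0 < -b') then 1 else 0) :
    g b c - g b (-c) + g (-b) (-c) - g (-b) c =
      (if b * c < 0 then 1 else -1) * ((if a = 1 then 1 else 0) - (if a = 0 then 1 else 0)) := by
  rw [hg b c hb, hg b (-c) hb, hg (-b) (-c) (neg_ne_zero.2 hb), hg (-b) c (neg_ne_zero.2 hb)]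
  rcases lt_or_gt_of_ne hc with hc' | hc' <;> rcases lt_or_gt_of_ne hb with hb' | hb' <;>
  · have hbc : b * c < 0 ∨ 0 < b * c := by
      rcases lt_or_gt_of_ne (mul_ne_zero hb hc) with h | h
      · exact Or.inl h
      · exact Or.inr h
    have hs : (b * c < 0 ↔ (b < 0 ∧ 0 < c) ∨ (0 < b ∧ c < 0)) := by
      rw [mul_neg_iff]; tauto
    rcases lt_trichotomy a 0 with ha | ha | ha
    · have h1 : ¬ 0 < a := by linarith
      have h2 : a ≠ 0 := ha.ne
      have h3 : a ≠ 1 := by linarith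
      simp [h1, h2, h3]
    · subst ha
      simp [hs, hc', hb', not_lt.2 hc'.le, not_lt.2 hb'.le]
    · rcases lt_trichotomy a 1 with ha1 | ha1 | ha1
      · have h2 : a ≠ 0 := ha.ne'
        have h3 : a ≠ 1 := ha1.ne
        simp [ha, ha1, h2, h3, hc', not_lt.2 hc'.le]
      · subst ha1
        simp [hs, hc', hb', not_lt.2 hc'.le, not_lt.2 hb'.le]
      · have h1 : ¬ a < 1 := by linarith
        have h2 : a ≠ 0 := ha.ne'
        have h3 : a ≠ 1 := ha1.ne'
        have h4 : ¬ (1 - a = 0) := fun h => h3 (by linarith)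
        simp [h1, h2, h3, h4]

-- If x is not on the line of a side parallel to u, the second-order term is irrelevant and the four
-- indicators cancel in pairs. If it is, exactly one side is parallel to u and the case check for
-- that side applies.
open Classical in
theorem turn_eq (t : Affine.Triangle ℝ ℂ) (x : ℂ) {u : ℂ} (hu : u ≠ 0) :
    turn t x u = orientation t * ∑ k, if (bary t k).linear u = 0 then
      ((if x = t.points (k + 1) then 1 else 0) - (if x = t.points (k + 2) then 1 else 0) : ℝ)
      else 0 := by
  by_cases h : ∃ k, bary t k x = 0 ∧ (bary t k).linear u = 0
  · obtain ⟨k, hk0, hku⟩ := h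
    rw [Fin.sum_univ_three, ← fin_three_sum_cyclic (fun k => if (bary t k).linear u = 0 then
      ((if x = t.points (k + 1) then 1 else 0) - (if x = t.points (k + 2) then 1 else 0) : ℝ)
      else 0) k]
    have hLsum := sum_bary_linear t u
    rw [← fin_three_sum_cyclic (fun k => (bary t k).linear u) k] at hLsum
    simp only [hku, zero_add] at hLsum
    have hxsum := sum_bary t x
    rw [← fin_three_sum_cyclic (fun k => bary t k x) k] at hxsum
    simp only [hk0, zero_add] at hxsum
    obtain ⟨b, hb⟩ : ∃ b, b = (bary t (k + 1)).linear u := ⟨_, rfl⟩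
    obtain ⟨a, ha⟩ : ∃ a, a = bary t (k + 1) x := ⟨_, rfl⟩
    obtain ⟨c, hc⟩ : ∃ c, c = (bary t k).linear (Complex.I * u) := ⟨_, rfl⟩
    have hb2 : (bary t (k + 2)).linear u = -b := by linarith
    have ha2 : bary t (k + 2) x = 1 - a := by linarith
    have hb0 : b ≠ 0 := by
      intro h0
      apply hu
      rw [eq_bary_linear_smul t k u, hb2, ← hb, h0]
      simp
    have hc0 : c ≠ 0 := by
      rw [hc]; exact (bary_linear_ne_zero t k hu).resolve_left (fun h => h hku)
    have hside : cross (t.points (k + 2) - t.points (k + 1)) u = 0 := by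
      rw [← bary_linear_mul_signedArea, hku, zero_mul]
    -- Writing v for the side, u = -bv, and Cramer's rule at iu gives c · area = -b|v|².
    have hor : orientation t = if b * c < 0 then 1 else -1 := by
      have e1 := bary_linear_mul_signedArea t k (Complex.I * u)
      rw [← hc] at e1
      have hu2 := eq_bary_linear_smul t (k + 1) u
      have i1 : k + 1 + 1 = k + 2 := (fin_three_add k).1
      have i2 : k + 1 + 2 = k := (fin_three_add k).2.1
      rw [i1, i2, hku, zero_smul, add_zero, hb2] at hu2
      generalize t.points (k + 2) - t.points (k + 1) = v at e1 hu2
      have hv : v ≠ 0 := by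
        rintro rfl
        rw [smul_zero] at hu2
        exact hu hu2
      have hvpos : 0 < v.re ^ 2 + v.im ^ 2 := by
        have := Complex.normSq_pos.2 hv
        rw [Complex.normSq_apply] at this
        nlinarith
      have e2 : c * signedArea t = -b * (v.re ^ 2 + v.im ^ 2) := by
        rw [e1, hu2, cross_eq]
        simp
        ring
      have e3 : signedArea t * (c * c) = (b * c) * -(v.re ^ 2 + v.im ^ 2) := by
        linear_combination c * e2
      have hcc : 0 < c * c := mul_self_pos.2 hc0
      have : 0 < signedArea t ↔ b * c < 0 := by
        constructor
        · intro h
          by_contra! h'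
          have := mul_pos h hcc
          nlinarith
        · intro h
          by_contra! h'
          nlinarith
      simp only [orientation, this]
    have hL1 : (bary t (k + 1)).linear u ≠ 0 := by rw [← hb]; exact hb0
    have hL2 : (bary t (k + 2)).linear u ≠ 0 := by rw [hb2]; exact neg_ne_zero.2 hb0
    rw [if_pos hku, if_neg hL1, if_neg hL2, add_zero, add_zero, hor]
    have hp1 : x = t.points (k + 1) ↔ a = 1 := by
      have i1 : k + 1 + 1 = k + 2 := (fin_three_add k).1
      have i2 : k + 1 + 2 = k := (fin_three_add k).2.1
      constructor
      · intro h; rw [ha, h, bary_points_self]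
      · intro h
        apply eq_points_of_bary
        · rw [← ha, h]
        · rw [i1, ha2, h, sub_self]
        · rw [i2, hk0]
    have hp2 : x = t.points (k + 2) ↔ a = 0 := by
      have i1 : k + 2 + 1 = k := (fin_three_add k).2.2.1
      have i2 : k + 2 + 2 = k + 1 := (fin_three_add k).2.2.2
      constructor
      · intro h
        rw [ha, h, bary_points, if_neg (fin_three_ne k).2.2.1]
      · intro h
        apply eq_points_of_bary
        · rw [ha2, h, sub_zero]
        · rw [i1, hk0]
        · rw [i2, ← ha, h]
    simp only [hp1, hp2]
    have hgen : ∀ (b' c' : ℝ) (w w' : ℂ), b' ≠ 0 → (bary t k).linear w = 0 →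
        (bary t (k + 1)).linear w = b' → (bary t (k + 2)).linear w = -b' →
        (bary t k).linear w' = c' → germInd t x w w' =
        if 0 < c' ∧ (0 < a ∨ a = 0 ∧ 0 < b') ∧ (0 < 1 - a ∨ 1 - a = 0 ∧ 0 < -b')
          then 1 else 0 := by
      intro b' c' w w' hb' h1 h2 h3 h4
      have : HasGerm t x w w' ↔
          0 < c' ∧ (0 < a ∨ a = 0 ∧ 0 < b') ∧ (0 < 1 - a ∨ 1 - a = 0 ∧ 0 < -b') := by
        rw [HasGerm, forall_fin_three_cyclic k, h1, h2, h3, h4, hk0, ← ha, ha2,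
          lexPos_iff_of_ne hb', lexPos_iff_of_ne (neg_ne_zero.2 hb')]
        simp [LexPos]
      simp only [germInd, this]
    rw [turn, hgen b c u (Complex.I * u) hb0 hku hb.symm hb2 hc.symm,
      hgen b (-c) u (-(Complex.I * u)) hb0 hku hb.symm hb2 (by rw [map_neg, hc]),
      hgen (-b) (-c) (-u) (-(Complex.I * u)) (neg_ne_zero.2 hb0) (by rw [map_neg, hku, neg_zero])
        (by rw [map_neg, hb]) (by rw [map_neg, hb2]) (by rw [map_neg, hc]),
      hgen (-b) c (-u) (Complex.I * u) (neg_ne_zero.2 hb0) (by rw [map_neg, hku, neg_zero])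
        (by rw [map_neg, hb]) (by rw [map_neg, hb2]) hc.symm]
    exact indicator_alternating (g := fun b' c' =>
      if 0 < c' ∧ (0 < a ∨ a = 0 ∧ 0 < b') ∧ (0 < 1 - a ∨ 1 - a = 0 ∧ 0 < -b') then 1 else 0)
      hb0 hc0 (fun _ _ _ => rfl)
  · push Not at h
    have hu' : ∀ k, ¬ (bary t k x = 0 ∧ (bary t k).linear u = 0) := fun k hk => h k hk.1 hk.2
    have hnu : ∀ k, ¬ (bary t k x = 0 ∧ (bary t k).linear (-u) = 0) := fun k hk =>
      h k hk.1 (by simpa using hk.2)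
    rw [turn, germInd_congr hu' (Complex.I * u) (-(Complex.I * u)),
      germInd_congr hnu (Complex.I * u) (-(Complex.I * u)), sub_self, zero_add, sub_self,
      Finset.sum_eq_zero, mul_zero]
    intro k _
    split_ifs with h1 h2 h3 h3
    · exact absurd (h2.symm.trans h3)
        (fun h => (fin_three_ne k).2.2.1 (t.independent.injective h))
    · exact absurd h1 (h k (by
        rw [h2, bary_points, if_neg (fin_three_ne k).1.symm]))
    · exact absurd h1 (h k (by
        rw [h3, bary_points, if_neg (fin_three_ne k).2.1.symm]))
    · simp
    · rfl

theorem cross_mul_unitPt (n : ℕ) (a b : ℝ) (r : ℂ) (i j : ℤ) :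
    cross (a * (r * unitPt n i)) (b * (r * unitPt n j)) =
      a * b * Complex.normSq r * sin ((j - i : ℤ) * π / n) := by
  rw [cross, map_mul, map_mul, Complex.conj_ofReal, conj_unitPt]
  have : (a : ℂ) * ((starRingEnd ℂ) r * unitPt n (-i)) * (b * (r * unitPt n j)) =
      ((a * b * Complex.normSq r : ℝ) : ℂ) * unitPt n (j - i) := by
    rw [sub_eq_neg_add j i, unitPt_add]
    push_cast
    rw [Complex.normSq_eq_conj_mul_self]
    ring
  rw [this, Complex.im_ofReal_mul, unitPt_im]

/-- The function whose differences along lines of direction `r * unitPt n j` compute the cross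
products of the twisted end points. -/
noncomputable def directionPotential (n : ℕ) (k j : ℤ) (z : ℂ) : ℝ :=
  (unitPt n (-(k * j)) * z).re * (unitPt n (-(k * j)) * z).im

/-- After rotating the direction to the real axis both points have the same imaginary part y, and
the cross product of x + iy and x' + iy is xy - x'y. -/
theorem cross_eq_directionPotential_sub (n : ℕ) (k j : ℤ) (z : ℂ) (ρ : ℝ) :
    cross z (z + ρ * unitPt n (k * j)) =
      directionPotential n k j z - directionPotential n k j (z + ρ * unitPt n (k * j)) := by
  have h1 : unitPt n (-(k * j)) * (z + ρ * unitPt n (k * j)) = unitPt n (-(k * j)) * z + ρ := by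
    have : unitPt n (-(k * j)) * unitPt n (k * j) = 1 := by
      rw [← unitPt_add, neg_add_cancel, unitPt_zero]
    linear_combination (ρ : ℂ) * this
  have h2 : cross z (z + ρ * unitPt n (k * j)) =
      cross (unitPt n (-(k * j)) * z) (unitPt n (-(k * j)) * z + ρ) := by
    rw [← h1, cross, cross, map_mul, conj_unitPt, neg_neg]
    have : unitPt n (k * j) * unitPt n (-(k * j)) = 1 := by
      rw [← unitPt_add, add_neg_cancel, unitPt_zero]
    congr 1
    linear_combination (-(starRingEnd ℂ) z * (z + ρ * unitPt n (k * j))) * this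
  rw [h2, directionPotential, directionPotential, h1, cross_eq]
  simp only [Complex.add_re, Complex.add_im, Complex.ofReal_re, Complex.ofReal_im]
  ring

/-- The side of `t` opposite to vertex `l` has one of the directions `r * unitPt n j`. -/
def IsAligned (n : ℕ) (r : ℂ) (t : Affine.Triangle ℝ ℂ) (l : Fin 3) : Prop :=
  ∃ j : Fin n, (bary t l).linear (r * unitPt n (j : ℕ)) = 0

theorem side_ne_zero (t : Affine.Triangle ℝ ℂ) (l : Fin 3) :
    t.points (l + 2) - t.points (l + 1) ≠ 0 :=
  sub_ne_zero.2 fun h => (fin_three_ne l).2.2.2 (t.independent.injective h)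

theorem side_eq_of_linear_eq_zero {t : Affine.Triangle ℝ ℂ} {l : Fin 3} {w : ℂ} (hw : w ≠ 0)
    (h : (bary t l).linear w = 0) :
    ∃ τ : ℝ, t.points (l + 2) - t.points (l + 1) = τ * w := by
  have hu2 := eq_bary_linear_smul t (l + 1) w
  rw [(fin_three_add l).1, (fin_three_add l).2.1, h, zero_smul, add_zero, Complex.real_smul] at hu2
  have h0 : (bary t (l + 2)).linear w ≠ 0 := by
    intro h0
    rw [h0, Complex.ofReal_zero, zero_mul] at hu2
    exact hw hu2
  refine ⟨((bary t (l + 2)).linear w)⁻¹, ?_⟩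
  generalize (bary t (l + 2)).linear w = x at *
  have h0' : (x : ℂ) ≠ 0 := by exact_mod_cast h0
  rw [hu2]
  push_cast
  rw [inv_mul_cancel_left₀ h0']

theorem isAligned_of_side {n : ℕ} (hn : n ≠ 0) {r : ℂ} {t : Affine.Triangle ℝ ℂ} {l : Fin 3} {j : ℤ}
    {τ : ℝ} (h : t.points (l + 2) - t.points (l + 1) = τ * (r * unitPt n j)) :
    IsAligned n r t l := by
  have hj0 := Int.emod_nonneg j (by exact_mod_cast hn : (n : ℤ) ≠ 0)
  have hj1 := Int.emod_lt_of_pos j (by omega : (0 : ℤ) < n)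
  have hτ : τ ≠ 0 := by
    rintro rfl
    exact side_ne_zero t l (by rw [h]; simp)
  refine ⟨⟨(j % n).toNat, by omega⟩, ?_⟩
  have hL : (bary t l).linear (t.points (l + 2) - t.points (l + 1)) = 0 := by
    rw [bary_linear_sub, bary_points, bary_points, if_neg (fin_three_ne l).2.1.symm,
      if_neg (fin_three_ne l).1.symm, sub_zero]
  rw [h, ← Complex.real_smul, map_smul, smul_eq_mul] at hL
  have hL2 := (mul_eq_zero.1 hL).resolve_left hτ
  simp only [Int.toNat_of_nonneg hj0]
  -- Adding n to j only reverses the direction, so lines are indexed modulo n.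
  have hsq : unitPt n (n * (j / n)) * unitPt n (n * (j / n)) = 1 := by
    rw [← unitPt_add, ← two_mul, ← mul_assoc]
    exact unitPt_two_mul_self hn _
  have hdecomp : unitPt n j = unitPt n (j % n) * unitPt n (n * (j / n)) := by
    rw [← unitPt_add, Int.emod_add_mul_ediv]
  rcases mul_self_eq_one_iff.1 hsq with h1 | h1
  · rwa [hdecomp, h1, mul_one] at hL2
  · rw [hdecomp, h1, mul_neg_one, mul_neg, map_neg, neg_eq_zero] at hL2
    exact hL2

/-- The cross product of the side with itself is a nonzero multiple of sin((j - i)π/n), and |j - i|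
< n. -/
theorem aligned_direction_unique {n : ℕ} (hn : n ≠ 0) {r : ℂ} (hr : r ≠ 0)
    {t : Affine.Triangle ℝ ℂ} {l : Fin 3} {i j : Fin n}
    (hi : (bary t l).linear (r * unitPt n (i : ℕ)) = 0)
    (hj : (bary t l).linear (r * unitPt n (j : ℕ)) = 0) : i = j := by
  have hw : ∀ d : ℤ, r * unitPt n d ≠ 0 := fun d => mul_ne_zero hr (unitPt_ne_zero _ _)
  obtain ⟨σ, hσ⟩ := side_eq_of_linear_eq_zero (hw _) hi
  obtain ⟨τ, hτ⟩ := side_eq_of_linear_eq_zero (hw _) hj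
  have hc : cross (t.points (l + 2) - t.points (l + 1)) (t.points (l + 2) - t.points (l + 1)) = 0 := by
    rw [cross_eq]; ring
  nth_rw 1 [hσ] at hc
  rw [hτ, cross_mul_unitPt] at hc
  have hσ0 : σ ≠ 0 := by rintro rfl; exact side_ne_zero t l (by rw [hσ]; simp)
  have hτ0 : τ ≠ 0 := by rintro rfl; exact side_ne_zero t l (by rw [hτ]; simp)
  have hs : sin (((j : ℕ) - (i : ℕ) : ℤ) * π / n) = 0 := by
    refine (mul_eq_zero.1 hc).resolve_left ?_
    exact mul_ne_zero (mul_ne_zero hσ0 hτ0) (by simpa using hr)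
  obtain ⟨q, hq⟩ := sin_eq_zero_iff.1 hs
  have hpi := pi_ne_zero
  have hnr : (n : ℝ) ≠ 0 := by exact_mod_cast hn
  have hq2 : (q * n : ℝ) = ((j : ℕ) - (i : ℕ) : ℤ) := by
    field_simp at hq
    exact hq
  have hq3 : q * n = ((j : ℕ) - (i : ℕ) : ℤ) := by exact_mod_cast hq2
  have h1 := i.2
  have h2 := j.2
  have hq0 : q = 0 := by
    by_contra hq0
    rcases lt_or_gt_of_ne hq0 with h | h <;> nlinarith
  rw [hq0] at hq3
  ext
  omega

section twist

variable {n : ℕ} {k : ℤ} {F : ℂ →+ ℂ}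

/-- The twist `F` in the affine coordinate `(x - c) / r`. -/
noncomputable def twistAt (F : ℂ →+ ℂ) (c r x : ℂ) : ℂ := F ((x - c) / r)

theorem twistAt_sub (F : ℂ →+ ℂ) (c r x y : ℂ) :
    twistAt F c r x - twistAt F c r y = F ((x - y) / r) := by
  rw [twistAt, twistAt, ← map_sub]; congr 1; ring

theorem cross_twistAt (hF : IsTwist n k F) {c r : ℂ} (hr : r ≠ 0) {x y : ℂ} {τ : ℝ} {j : ℤ}
    (h : y - x = τ * (r * unitPt n j)) :
    cross (twistAt F c r x) (twistAt F c r y) =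
      directionPotential n k j (twistAt F c r x) - directionPotential n k j (twistAt F c r y) := by
  have e : twistAt F c r y = twistAt F c r x + ((F τ).re : ℝ) * unitPt n (k * j) := by
    have h1 := twistAt_sub F c r y x
    have h2 : (τ : ℂ) * (r * unitPt n j) / r = τ * unitPt n j := by field_simp
    rw [h, h2, hF.ofReal_mul_unitPt] at h1
    linear_combination h1
  rw [e]
  exact cross_eq_directionPotential_sub n k j _ _

/-- The contribution of a triangle to the twisted area, as a sum over points and directions. -/
noncomputable def flux (n : ℕ) (k : ℤ) (F : ℂ →+ ℂ) (c r : ℂ) (V : Finset ℂ)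
    (t : Affine.Triangle ℝ ℂ) : ℝ :=
  ∑ j : Fin n, ∑ x ∈ V, turn t x (r * unitPt n (j : ℕ)) *
    directionPotential n k (j : ℕ) (twistAt F c r x)

-- By `turn_eq` only ends of sides contribute. An aligned side is seen by exactly one direction, for
-- which its potential difference is the cross product of its twisted ends.
open Classical in
theorem flux_eq_sum (hn : n ≠ 0) (hF : IsTwist n k F) {c r : ℂ} (hr : r ≠ 0) {V : Finset ℂ}
    {t : Affine.Triangle ℝ ℂ} (hV : ∀ l, t.points l ∈ V) :
    flux n k F c r V t = orientation t * ∑ l, if IsAligned n r t l then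
      cross (twistAt F c r (t.points (l + 1))) (twistAt F c r (t.points (l + 2))) else 0 := by
  have hw : ∀ d : ℤ, r * unitPt n d ≠ 0 := fun d => mul_ne_zero hr (unitPt_ne_zero _ _)
  have h1 : ∀ j : Fin n, ∑ x ∈ V, turn t x (r * unitPt n (j : ℕ)) *
      directionPotential n k (j : ℕ) (twistAt F c r x) =
      orientation t * ∑ l, if (bary t l).linear (r * unitPt n (j : ℕ)) = 0 then
        directionPotential n k (j : ℕ) (twistAt F c r (t.points (l + 1))) -
          directionPotential n k (j : ℕ) (twistAt F c r (t.points (l + 2))) else 0 := by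
    intro j
    simp only [turn_eq t _ (hw (j : ℕ)), mul_assoc, Finset.sum_mul]
    rw [← Finset.mul_sum, Finset.sum_comm]
    congr 1
    refine Finset.sum_congr rfl fun l _ => ?_
    split_ifs
    · simp only [sub_mul, Finset.sum_sub_distrib, ite_mul, one_mul, zero_mul, Finset.sum_ite_eq',
        hV, if_true]
    · simp
  rw [flux]
  simp only [h1]
  rw [← Finset.mul_sum, Finset.sum_comm]
  congr 1
  refine Finset.sum_congr rfl fun l _ => ?_
  split_ifs with h
  · obtain ⟨j, hj⟩ := h
    rw [Finset.sum_eq_single j]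
    · rw [if_pos hj]
      obtain ⟨τ, hτ⟩ := side_eq_of_linear_eq_zero (hw _) hj
      exact (cross_twistAt hF hr hτ).symm
    · intro i _ hij
      rw [if_neg]
      exact fun hi => hij (aligned_direction_unique hn hr hi hj)
    · simp
  · refine Finset.sum_eq_zero fun j _ => ?_
    rw [if_neg]
    exact fun hj => h ⟨j, hj⟩

/-- The shoelace formula. -/
theorem sum_cross_cyclic (g : Fin 3 → ℂ) (m : Fin 3) :
    ∑ l, cross (g (l + 1)) (g (l + 2)) = cross (g (m + 1) - g m) (g (m + 2) - g m) := by
  rw [Fin.sum_univ_three, ← fin_three_sum_cyclic (fun l => cross (g (l + 1)) (g (l + 2))) m]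
  simp only [(fin_three_add m).1, (fin_three_add m).2.1, (fin_three_add m).2.2.1,
    (fin_three_add m).2.2.2, cross_eq, Complex.sub_re, Complex.sub_im]
  ring

theorem eq_mul_unitPt_of_angle {n : ℕ} {p q : ℂ} (hp : p ≠ 0) (hq : q ≠ 0) {d : ℤ}
    (h : InnerProductGeometry.angle p q = d * π / n) :
    ∃ η : ℤ, (η = 1 ∨ η = -1) ∧ q = ((‖q‖ / ‖p‖ : ℝ) : ℂ) * (p * unitPt n (η * d)) := by
  rw [InnerProductGeometry.angle_comm, Complex.angle_eq_abs_arg hq hp] at h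
  have hrep : q = ((‖q‖ / ‖p‖ : ℝ) : ℂ) * (p * Complex.exp ((q / p).arg * Complex.I)) := by
    have := Complex.norm_mul_exp_arg_mul_I (q / p)
    rw [norm_div] at this
    have h2 : q = q / p * p := by field_simp
    conv_lhs => rw [h2, ← this]
    ring
  rcases abs_choice (q / p).arg with h1 | h1
  · refine ⟨1, Or.inl rfl, ?_⟩
    rw [one_mul, unitPt, ← h, h1]
    exact hrep
  · refine ⟨-1, Or.inr rfl, ?_⟩
    have : ((-1 * d : ℤ) * π / n : ℝ) = (q / p).arg := by
      push_cast
      linarith [show (-1 * d * π / n : ℝ) = -(d * π / n) by ring]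
    rw [unitPt, this]
    exact hrep

/-- Turning by a multiple of π/n permutes the allowed directions, so such a triangle is aligned on
all sides or on none. -/
theorem IsAligned.all {n : ℕ} (hn : n ≠ 0) {r : ℂ} (hr : r ≠ 0) {t : Affine.Triangle ℝ ℂ}
    (hang : ∀ l, ∃ d : ℤ, triangleAngle t l = d * π / n) {l : Fin 3} (h : IsAligned n r t l)
    (m : Fin 3) : IsAligned n r t m := by
  have step : ∀ l, IsAligned n r t (l + 1) → IsAligned n r t l := by
    intro l ⟨j, hj⟩
    obtain ⟨τ, hτ⟩ := side_eq_of_linear_eq_zero (mul_ne_zero hr (unitPt_ne_zero _ _)) hj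
    have hne1 := side_ne_zero t (l + 1)
    have hne2 := side_ne_zero t l
    rw [(fin_three_add l).1, (fin_three_add l).2.1] at hτ hne1
    obtain ⟨d, hd⟩ := hang (l + 2)
    rw [triangleAngle, (fin_three_add l).2.2.1, (fin_three_add l).2.2.2, EuclideanGeometry.angle,
      vsub_eq_sub, vsub_eq_sub] at hd
    have hne2' : t.points (l + 1) - t.points (l + 2) ≠ 0 := by
      rw [← neg_sub]; exact neg_ne_zero.2 hne2
    obtain ⟨η, -, hη⟩ := eq_mul_unitPt_of_angle hne1 hne2' hd
    generalize (‖t.points (l + 1) - t.points (l + 2)‖ / ‖t.points l - t.points (l + 2)‖ : ℝ) = s at hη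
    rw [hτ] at hη
    refine isAligned_of_side (j := (j : ℕ) + η * d) (τ := -(s * τ)) hn ?_
    rw [← neg_sub, hη, unitPt_add]
    push_cast
    ring
  have h1 : ∀ l, IsAligned n r t l → IsAligned n r t (l + 2) := fun l h =>
    step (l + 2) (by rwa [(fin_three_add l).2.2.1])
  rcases fin_three_cases l m with rfl | rfl | rfl
  · exact h
  · have := h1 _ (h1 _ h)
    rwa [(fin_three_add l).2.2.2] at this
  · exact h1 _ h

theorem flux_eq_zero (hn : n ≠ 0) (hF : IsTwist n k F) {c r : ℂ} (hr : r ≠ 0) {V : Finset ℂ}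
    {t : Affine.Triangle ℝ ℂ} (hV : ∀ l, t.points l ∈ V) (h : ∀ l, ¬ IsAligned n r t l) :
    flux n k F c r V t = 0 := by
  rw [flux_eq_sum hn hF hr hV, Finset.sum_eq_zero, mul_zero]
  intro l _
  rw [if_neg (h l)]

theorem flux_eq_cross (hn : n ≠ 0) (hF : IsTwist n k F) {c r : ℂ} (hr : r ≠ 0) {V : Finset ℂ}
    {t : Affine.Triangle ℝ ℂ} (hV : ∀ l, t.points l ∈ V) (h : ∀ l, IsAligned n r t l) (m : Fin 3) :
    flux n k F c r V t = orientation t *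
      cross (F ((t.points (m + 1) - t.points m) / r)) (F ((t.points (m + 2) - t.points m) / r)) := by
  rw [flux_eq_sum hn hF hr hV, ← twistAt_sub F c, ← twistAt_sub F c,
    ← sum_cross_cyclic (fun l => twistAt F c r (t.points l)) m]
  simp only [h, if_true]

/-- The weight of `turn` in `flux` depends only on the point and the direction, so equality of the
turn sums suffices. -/
theorem sum_flux_eq {ι κ : Type*} [Fintype ι] [Fintype κ] {T : ι → Affine.Triangle ℝ ℂ}
    {S : κ → Affine.Triangle ℝ ℂ}
    (hU : (⋃ i, triangleRegion (T i)) = ⋃ i, triangleRegion (S i))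
    (hT : ∀ i j, i ≠ j → Disjoint (interior (triangleRegion (T i))) (interior (triangleRegion (T j))))
    (hS : ∀ i j, i ≠ j → Disjoint (interior (triangleRegion (S i))) (interior (triangleRegion (S j))))
    (c : ℂ) {r : ℂ} (hr : r ≠ 0) (V : Finset ℂ) :
    ∑ i, flux n k F c r V (T i) = ∑ i, flux n k F c r V (S i) := by
  simp only [flux]
  rw [Finset.sum_comm, Finset.sum_comm (γ := κ)]
  refine Finset.sum_congr rfl fun j _ => ?_
  rw [Finset.sum_comm, Finset.sum_comm (γ := κ)]
  refine Finset.sum_congr rfl fun x _ => ?_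
  rw [← Finset.sum_mul, ← Finset.sum_mul, sum_turn_eq hU hT hS x
    (mul_ne_zero hr (unitPt_ne_zero _ _))]

end twist

/-! ### Exclusion of the 28-gon -/

theorem unitPt_twentyEight_fourteen : unitPt 28 14 = Complex.I := by
  apply Complex.ext
  · rw [unitPt_re]
    have : ((14 : ℤ) * π / (28 : ℕ) : ℝ) = π / 2 := by push_cast; ring
    rw [this, cos_pi_div_two, Complex.I_re]
  · rw [unitPt_im]
    have : ((14 : ℤ) * π / (28 : ℕ) : ℝ) = π / 2 := by push_cast; ring
    rw [this, sin_pi_div_two, Complex.I_im]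

theorem unitPt_twentyEight_fortyTwo : unitPt 28 42 = -Complex.I := by
  have : (42 : ℤ) = 14 + (14 + 14) := by norm_num
  rw [this, unitPt_add, unitPt_add, unitPt_twentyEight_fourteen, Complex.I_mul_I]
  ring

/-- Apply F to 2i sin(dπ/28) = ζ^d - ζ^(-d), where ζ = exp(iπ/28). The minus sign arises because i =
ζ^14 goes to ζ^42 = -i. -/
theorem IsTwist.sin_mul {F : ℂ →+ ℂ} (hF : IsTwist 28 3 F) (d : ℤ) (x : ℝ) :
    (F ((2 * sin (d * π / 28) * x : ℝ) : ℂ)).re =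
      -(2 * sin ((3 * d : ℤ) * π / 28) * (F x).re) := by
  have h1 := hF.unitPt_mul d x
  have h2 := hF.unitPt_mul (-d) x
  have h3 : F (unitPt 28 14 * ((2 * sin (d * π / 28) * x : ℝ) : ℂ)) =
      2 * sin ((3 * d : ℤ) * π / 28) * Complex.I * F x := by
    have e1 : unitPt 28 14 * ((2 * sin (d * π / 28) * x : ℝ) : ℂ) =
        unitPt 28 d * x - unitPt 28 (-d) * x := by
      have := unitPt_sub_unitPt_neg 28 d
      rw [← sub_mul, this, unitPt_twentyEight_fourteen]
      push_cast
      ring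
    have e2 := unitPt_sub_unitPt_neg 28 (3 * d)
    rw [e1, map_sub, h1, h2, ← sub_mul, mul_neg, e2]
    push_cast
    ring
  have e3 : unitPt 28 (3 * 14) = -Complex.I := unitPt_twentyEight_fortyTwo
  rw [hF.unitPt_mul, e3] at h3
  have h4 : F ((2 * sin (d * π / 28) * x : ℝ) : ℂ) = -(2 * sin ((3 * d : ℤ) * π / 28) * F x) := by
    apply mul_left_cancel₀ (neg_ne_zero.2 Complex.I_ne_zero)
    rw [h3]
    ring
  rw [h4, hF.map_ofReal x]
  simp only [Complex.neg_re, ← Complex.ofReal_ofNat, ← Complex.ofReal_mul, Complex.ofReal_re]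

theorem sin_twist_pos {d : ℤ} (h : d = 6 ∨ d = 8) : 0 < sin ((3 * d : ℤ) * π / 28) := by
  have hpi := pi_pos
  rcases h with rfl | rfl
  · apply sin_pos_of_pos_of_lt_pi <;> push_cast <;> linarith
  · apply sin_pos_of_pos_of_lt_pi <;> push_cast <;> linarith

theorem sin_mul_dist_eq (t : Affine.Triangle ℝ ℂ) (m : Fin 3) :
    sin (triangleAngle t (m + 1)) * ‖t.points (m + 1) - t.points m‖ =
      sin (triangleAngle t (m + 2)) * ‖t.points (m + 2) - t.points m‖ := by
  rw [triangleAngle, triangleAngle, (fin_three_add m).1, (fin_three_add m).2.1,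
    (fin_three_add m).2.2.1, (fin_three_add m).2.2.2]
  have := law_sin (t.points (m + 2)) (t.points (m + 1)) (t.points m)
  rwa [dist_eq_norm, dist_comm, dist_eq_norm] at this

/-- A right triangle with acute angles `6 π / 28` and `8 π / 28` has non-positive twisted area. -/
theorem flux_nonpos {F : ℂ →+ ℂ} (hF : IsTwist 28 3 F) {c r : ℂ} (hr : r ≠ 0) {V : Finset ℂ}
    {t : Affine.Triangle ℝ ℂ} (hV : ∀ l, t.points l ∈ V) {m : Fin 3} {d₁ d₂ : ℤ}
    (hd₁ : d₁ = 6 ∨ d₁ = 8) (hd₂ : d₂ = 6 ∨ d₂ = 8)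
    (h0 : triangleAngle t m = π / 2) (h1 : triangleAngle t (m + 1) = d₁ * π / 28)
    (h2 : triangleAngle t (m + 2) = d₂ * π / 28) :
    flux 28 3 F c r V t ≤ 0 := by
  by_cases hal : ∃ l, IsAligned 28 r t l
  swap
  · push Not at hal
    rw [flux_eq_zero (by norm_num) hF hr hV hal]
  obtain ⟨l, hl⟩ := hal
  have hang : ∀ l, ∃ d : ℤ, triangleAngle t l = d * π / (28 : ℕ) := by
    intro l
    rcases fin_three_cases m l with rfl | rfl | rfl
    · exact ⟨14, by rw [h0]; push_cast; ring⟩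
    · exact ⟨d₁, by rw [h1]; push_cast; ring⟩
    · exact ⟨d₂, by rw [h2]; push_cast; ring⟩
  have hall := hl.all (by norm_num) hr hang
  rw [flux_eq_cross (by norm_num) hF hr hV hall m]
  obtain ⟨j, hj⟩ := hall (m + 2)
  obtain ⟨a, ha⟩ := side_eq_of_linear_eq_zero (mul_ne_zero hr (unitPt_ne_zero _ _)) hj
  have hpne := side_ne_zero t (m + 2)
  have hqne : t.points (m + 2) - t.points m ≠ 0 :=
    sub_ne_zero.2 fun h => (fin_three_ne m).2.1 (t.independent.injective h)
  rw [(fin_three_add m).2.2.1, (fin_three_add m).2.2.2] at ha hpne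
  have hlaw := sin_mul_dist_eq t m
  have hA := signedArea_eq t m
  have h0' := h0
  rw [triangleAngle, EuclideanGeometry.angle, vsub_eq_sub, vsub_eq_sub] at h0'
  obtain ⟨η, hη1, hη⟩ := eq_mul_unitPt_of_angle (n := 28) (d := 14) hpne hqne
    (by rw [h0']; push_cast; ring)
  rw [h1, h2] at hlaw
  generalize t.points (m + 1) - t.points m = p at *
  generalize t.points (m + 2) - t.points m = q at *
  have hpn : 0 < ‖p‖ := norm_pos_iff.2 hpne
  have hqn : 0 < ‖q‖ := norm_pos_iff.2 hqne
  obtain ⟨s, hs⟩ : ∃ s : ℝ, s = ‖q‖ / ‖p‖ := ⟨_, rfl⟩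
  have hs0 : 0 < s := by rw [hs]; positivity
  have ha0 : a ≠ 0 := by rintro rfl; exact hpne (by rw [ha]; simp)
  have hlaw2 : sin (d₁ * π / 28) = sin (d₂ * π / 28) * s := by
    rw [hs, mul_div_assoc', eq_div_iff hpn.ne']; exact hlaw
  rw [← hs] at hη
  have hq : q = ((s * a : ℝ) : ℂ) * (r * unitPt 28 ((j : ℕ) + η * 14)) := by
    rw [hη, ha, unitPt_add]; push_cast; ring
  have hsinη : sin ((η * 14 : ℤ) * π / (28 : ℕ)) = η := by
    rcases hη1 with rfl | rfl
    · have : ((1 * 14 : ℤ) * π / (28 : ℕ) : ℝ) = π / 2 := by push_cast; ring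
      rw [this, sin_pi_div_two]; simp
    · have : ((-1 * 14 : ℤ) * π / (28 : ℕ) : ℝ) = -(π / 2) := by push_cast; ring
      rw [this, sin_neg, sin_pi_div_two]; simp
  -- The twist sends the right angle to 42π/28 = 3π/2, which reverses the orientation.
  have hsinη3 : sin ((3 * (η * 14) : ℤ) * π / (28 : ℕ)) = -η := by
    have hb : sin (3 * π / 2) = -1 := by
      have : 3 * π / 2 = π / 2 + π := by ring
      rw [this, sin_add_pi, sin_pi_div_two]
    rcases hη1 with rfl | rfl
    · have : ((3 * (1 * 14) : ℤ) * π / (28 : ℕ) : ℝ) = 3 * π / 2 := by push_cast; ring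
      rw [this, hb]; simp
    · have : ((3 * (-1 * 14) : ℤ) * π / (28 : ℕ) : ℝ) = -(3 * π / 2) := by push_cast; ring
      rw [this, sin_neg, hb]; simp
  have hηη : (η * η : ℝ) = 1 := by rcases hη1 with rfl | rfl <;> simp
  have hor : orientation t = η := by
    have : signedArea t = a * (s * a) * Complex.normSq r * η := by
      rw [hA, hq, ha, cross_mul_unitPt, add_sub_cancel_left, hsinη]
    have hpos : 0 < a * (s * a) * Complex.normSq r := by
      have := Complex.normSq_pos.2 hr
      have : 0 < a * a := mul_self_pos.2 ha0
      have : 0 < a * (s * a) := by nlinarith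
      positivity
    rw [orientation, this]
    rcases hη1 with rfl | rfl
    · rw [if_pos (by simpa using hpos)]; simp
    · rw [if_neg (by push_cast; linarith)]; simp
  have hFp : F (p / r) = ((F a).re : ℝ) * (1 * unitPt 28 (3 * (j : ℕ))) := by
    rw [ha, one_mul, ← hF.ofReal_mul_unitPt]; congr 1; field_simp
  have hFq : F (q / r) = ((F (s * a : ℝ)).re : ℝ) * (1 * unitPt 28 (3 * ((j : ℕ) + η * 14))) := by
    rw [hq, one_mul, ← hF.ofReal_mul_unitPt]; congr 1; field_simp
  -- F is applied to the law of sines. The two minus signs cancel and both twisted sines are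
  -- positive, so the twisted legs have equal signs. Strictness is not available, as F need not be
  -- injective.
  have hprod : 0 ≤ (F a).re * (F (s * a : ℝ)).re := by
    have e1 := hF.sin_mul d₁ a
    have e2 := hF.sin_mul d₂ (s * a)
    have e3 : 2 * sin (d₁ * π / 28) * a = 2 * sin (d₂ * π / 28) * (s * a) := by
      rw [hlaw2]; ring
    rw [e3, e2] at e1
    have p1 := sin_twist_pos hd₁
    have p2 := sin_twist_pos hd₂
    have e4 : sin ((3 * d₂ : ℤ) * π / 28) * (F (s * a : ℝ)).re =
        sin ((3 * d₁ : ℤ) * π / 28) * (F a).re := by linarith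
    have e5 : sin ((3 * d₂ : ℤ) * π / 28) * ((F a).re * (F (s * a : ℝ)).re) =
        sin ((3 * d₁ : ℤ) * π / 28) * ((F a).re * (F a).re) := by linear_combination (F a).re * e4
    have : 0 ≤ sin ((3 * d₁ : ℤ) * π / 28) * ((F a).re * (F a).re) :=
      mul_nonneg p1.le (mul_self_nonneg _)
    rw [← e5] at this
    exact nonneg_of_mul_nonneg_right this p2
  have hcr : cross (F (p / r)) (F (q / r)) = -((F a).re * (F (s * a : ℝ)).re * η) := by
    rw [hFp, hFq, cross_mul_unitPt]
    have : (3 * (((j : ℕ) : ℤ) + η * 14) - 3 * ((j : ℕ) : ℤ)) = 3 * (η * 14) := by ring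
    rw [this, hsinη3]
    simp
  rw [hcr, hor]
  have : (η : ℝ) * -((F a).re * (F (s * a : ℝ)).re * η) = -((F a).re * (F (s * a : ℝ)).re) := by
    linear_combination (-((F a).re * (F (s * a : ℝ)).re)) * hηη
  rw [this]
  linarith

/-- The two radii are unit vectors in the scaled coordinate, so their images are known exactly; the
angle between them becomes 6π/28, whose sine is positive. -/
theorem flux_fan_pos {F : ℂ →+ ℂ} (hF : IsTwist 28 3 F) (hn : 3 ≤ 28) (c : ℂ) {r : ℂ} (hr : r ≠ 0)
    {V : Finset ℂ} (k : Fin 28) (hV : ∀ l, (fanTriangle hn c hr k).points l ∈ V) :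
    0 < flux 28 3 F c r V (fanTriangle hn c hr k) := by
  have hpi := pi_pos
  have hang : ∀ l, ∃ d : ℤ, triangleAngle (fanTriangle hn c hr k) l = d * π / (28 : ℕ) := by
    intro l
    fin_cases l
    · exact ⟨2, by
        change triangleAngle (fanTriangle hn c hr k) 0 = _
        rw [fan_angle_center]; push_cast; ring⟩
    · exact ⟨13, by
        change triangleAngle (fanTriangle hn c hr k) 1 = _
        rw [(fan_angle_base hn c hr k).1]; push_cast; ring⟩
    · exact ⟨13, by
        change triangleAngle (fanTriangle hn c hr k) 2 = _
        rw [(fan_angle_base hn c hr k).2]; push_cast; ring⟩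
  have h2 : IsAligned 28 r (fanTriangle hn c hr k) 2 := by
    refine isAligned_of_side (j := 2 * (k : ℕ)) (τ := 1) (by norm_num) ?_
    change polyVertex c r 28 (k : ℕ) - c = _
    rw [polyVertex]; simp
  rw [flux_eq_cross (by norm_num) hF hr hV (h2.all (by norm_num) hr hang) 0]
  have e1 : (fanTriangle hn c hr k).points (0 + 1) - (fanTriangle hn c hr k).points 0 =
      (1 : ℝ) * (r * unitPt 28 (2 * (k : ℕ))) := by
    change polyVertex c r 28 (k : ℕ) - c = _
    rw [polyVertex]; simp
  have e2 : (fanTriangle hn c hr k).points (0 + 2) - (fanTriangle hn c hr k).points 0 =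
      (1 : ℝ) * (r * unitPt 28 (2 * ((k : ℕ) + 1))) := by
    change polyVertex c r 28 ((k : ℕ) + 1) - c = _
    rw [polyVertex]; simp
  have hA : 0 < signedArea (fanTriangle hn c hr k) := by
    rw [signedArea_eq _ 0, e1, e2, cross_mul_unitPt]
    have : (2 * (((k : ℕ) : ℤ) + 1) - 2 * ((k : ℕ) : ℤ)) = 2 := by ring
    rw [this]
    have h1 := Complex.normSq_pos.2 hr
    have h2 : 0 < sin ((2 : ℤ) * π / (28 : ℕ)) := by
      apply sin_pos_of_pos_of_lt_pi <;> push_cast <;> linarith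
    positivity
  have f1 : ∀ d : ℤ, F ((1 : ℝ) * (r * unitPt 28 d) / r) = (1 : ℝ) * (1 * unitPt 28 (3 * d)) := by
    intro d
    have : (1 : ℝ) * (r * unitPt 28 d) / r = unitPt 28 d := by push_cast; field_simp
    rw [this, hF.map_unitPt]
    simp
  rw [orientation, if_pos hA, one_mul, e1, e2, f1, f1, cross_mul_unitPt]
  have : (3 * (2 * (((k : ℕ) : ℤ) + 1)) - 3 * (2 * ((k : ℕ) : ℤ))) = 6 := by ring
  rw [this]
  have h2 : 0 < sin ((6 : ℤ) * π / (28 : ℕ)) := by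
    apply sin_pos_of_pos_of_lt_pi <;> push_cast <;> linarith
  simpa using h2

theorem perm_fin_three_cases (σ : Equiv.Perm (Fin 3)) :
    (σ 0 = σ 2 + 1 ∧ σ 1 = σ 2 + 2) ∨ (σ 1 = σ 2 + 1 ∧ σ 0 = σ 2 + 2) := by
  revert σ; decide

theorem not_tiling_regular_28_gon {c r : ℂ} (hr : r ≠ 0) {m : ℕ} {T : Fin m → Affine.Triangle ℝ ℂ}
    (hT : IsTiling T (convexHull ℝ (Set.range fun k : Fin 28 => polyVertex c r 28 (k : ℕ))))
    {σ : Fin m → Equiv.Perm (Fin 3)} (h : ∀ i, IsLabelling (T i) (3 * π / 14) (σ i)) : False := by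
  -- The exponent 3 is prime to 56. It makes the sine of the right angle negative and keeps those of
  -- both acute angles and of the central angle positive.
  obtain ⟨F, hF⟩ := exists_isTwist (n := 28) (k := 3) (by norm_num) (by norm_num)
  have hn : 3 ≤ 28 := by norm_num
  obtain ⟨V, hV1, hV2⟩ : ∃ V : Finset ℂ, (∀ i l, (T i).points l ∈ V) ∧
      ∀ k l, (fanTriangle hn c hr k).points l ∈ V := by
    have hfin := (Set.finite_range fun i : Fin m × Fin 3 => (T i.1).points i.2).union
      (Set.finite_range fun i : Fin 28 × Fin 3 => (fanTriangle hn c hr i.1).points i.2)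
    refine ⟨hfin.toFinset, fun i l => ?_, fun k l => ?_⟩
    · exact hfin.mem_toFinset.2 (Or.inl ⟨(i, l), rfl⟩)
    · exact hfin.mem_toFinset.2 (Or.inr ⟨(k, l), rfl⟩)
  have hsum : ∑ i, flux 28 3 F c r V (T i) =
      ∑ k, flux 28 3 F c r V (fanTriangle hn c hr k) := by
    exact sum_flux_eq (hT.1.trans (fan_iUnion hn c hr).symm) hT.2 (fan_disjoint hn c hr) c hr V
  have hle : ∑ i, flux 28 3 F c r V (T i) ≤ 0 := by
    refine Finset.sum_nonpos fun i _ => ?_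
    have hl := h i
    have ha : triangleAngle (T i) (σ i 0) = (6 : ℤ) * π / 28 := by
      rw [hl.small]; push_cast; ring
    have hb : triangleAngle (T i) (σ i 1) = (8 : ℤ) * π / 28 := by
      rw [hl.large]; push_cast; ring
    rcases perm_fin_three_cases (σ i) with ⟨e1, e2⟩ | ⟨e1, e2⟩
    · rw [e1] at ha
      rw [e2] at hb
      exact flux_nonpos hF hr (hV1 i) (Or.inl rfl) (Or.inr rfl) hl.right ha hb
    · rw [e2] at ha
      rw [e1] at hb
      exact flux_nonpos hF hr (hV1 i) (Or.inr rfl) (Or.inl rfl) hl.right hb ha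
  have hpos : 0 < ∑ k, flux 28 3 F c r V (fanTriangle hn c hr k) :=
    Finset.sum_pos (fun k _ => flux_fan_pos hF hn c hr k (hV2 k)) Finset.univ_nonempty
  linarith

/-! ### Conclusion -/

theorem corollary3 (n : ℕ) (hn : 9 ≤ n) (hn' : n ∉ ({12, 14, 20, 32, 44} : Set ℕ))
    (P : Set ℂ) (hP : IsRegularPolygon n P)
    (m : ℕ) (T : Fin m → Affine.Triangle ℝ ℂ) (hT : IsTiling T P)
    (hright : ∀ i, IsRightTriangle (T i))
    (hsim : ∀ i j, SimilarTriangles (T i) (T j)) :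
    ∃ α ∈ ({π / n, 2 * π / n} : Set ℝ), ∀ i, smallestAngle (T i) = α := by
  obtain ⟨-, c, r, hr, rfl⟩ := hP
  rw [regularPolygon_eq] at hT
  rcases m.eq_zero_or_pos with rfl | hm
  · exact ⟨π / n, by simp, fun i => i.elim0⟩
  have hall : ∀ i, smallestAngle (T i) = smallestAngle (T ⟨0, hm⟩) := fun i =>
    smallestAngle_of_similar (hsim i _)
  have hlab : ∀ i, ∃ σ, IsLabelling (T i) (smallestAngle (T ⟨0, hm⟩)) σ := by
    intro i
    rw [← hall i]
    exact (exists_labelling (hright i)).2.2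
  choose σ hσ using hlab
  obtain ⟨h0, h1, -⟩ := exists_labelling (hright ⟨0, hm⟩)
  refine ⟨_, ?_, hall⟩
  rcases smallestAngle_cases hn hn' hr hT h0 h1 hσ with h | h | ⟨rfl, h⟩
  · exact Or.inl h
  · exact Or.inr h
  · exact (not_tiling_regular_28_gon hr hT (h ▸ hσ)).elim
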